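/- Let $\kappa\le\lambda$ be uncountable cardinals with $\lambda^{<\kappa}=\lambda$. Then the following are equivalent: 1. $\kappa$ has the $\lambda$-filter extension property: every (proper) $\kappa$-complete filter on $\lambda$ extends to a $\kappa$-complete ultrafilter on $\lambda$. 2. For every transitive set $M$ such that $(M,\in)$ is a model of $\mathrm{ZFC}^-$ (ZFC without the power set axiom, with the collection scheme and the well-ordering principle), $2^\lambda\subseteq M$, $|M|=2^\lambda$ and ${}^{\kappa}M\subseteq M$, there are a transitive set $N$ and an elementary embedding $j\colon (M,\in)\to (N,\in)$ such that (a) $\mathrm{crit}(j)=\kappa$, i.e. $\kappa$ is the least ordinal moved by $j$; (b) ${}^{\kappa}N\subseteq N$; (c) there is $s\in N$ with $j``2^\lambda\subseteq s$ and $N\models |s|<j(\kappa)$. Here a filter is $\kappa$-complete if it is closed under intersections of fewer than $\kappa$ of its members, $2^\lambda$ is identified with the set of ordinals below it, ${}^{\kappa}X$ is the set of all functions from $\kappa$ to $X$, and $j``2^\lambda=\{j(\alpha):\alpha<2^\lambda\}$. -/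

import Mathlib

open Cardinal FirstOrder

universe u v

/-! ### The language of set theory and the theory ZFC without power set -/

/-- The only nonlogical symbol of the language of set theory: a binary relation symbol. -/
inductive SetTheoryRel : ℕ → Type
  | mem : SetTheoryRel 2

/-- The first-order language of set theory, with the single binary relation symbol `∈`. -/
def LSet : Language := ⟨fun _ => Empty, SetTheoryRel⟩

/-- The symbol `∈` of the language of set theory. -/
abbrev memSymb : LSet.Relations 2 := SetTheoryRel.mem

/-- A set `M`, regarded as the structure `(M, ∈)`. -/
instance ZFSet.structureLSet (M : ZFSet.{u}) : LSet.Structure M where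
  funMap f := nomatch f
  RelMap | .mem => fun x => (x 0 : ZFSet.{u}) ∈ (x 1 : ZFSet.{u})

namespace LSet

variable (A : Type v) [LSet.Structure A]

/-- The interpretation of `∈` in a structure for the language of set theory. -/
def E {A : Type v} [LSet.Structure A] (x y : A) : Prop :=
  Language.Structure.RelMap memSymb ![x, y]

/-- `w` is the unordered pair `{a, b}`, in the sense of the structure. -/
def IsUPair {A : Type v} [LSet.Structure A] (w a b : A) : Prop :=
  ∀ v, E v w ↔ v = a ∨ v = b

/-- `p` is the Kuratowski pair `{{a}, {a, b}}`, in the sense of the structure. -/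
def IsOPair {A : Type v} [LSet.Structure A] (p a b : A) : Prop :=
  ∀ w, E w p ↔ IsUPair w a a ∨ IsUPair w a b

/-- In the sense of the structure, `r` contains the ordered pair `(a, b)`. -/
def Related {A : Type v} [LSet.Structure A] (r a b : A) : Prop :=
  ∃ p, IsOPair p a b ∧ E p r

/-- In the sense of the structure, `r` is a strict well-order of the set `x`. -/
structure WellOrders {A : Type v} [LSet.Structure A] (r x : A) : Prop where
  irrefl : ∀ a, E a x → ¬ Related r a a
  trans : ∀ a b c, E a x → E b x → E c x → Related r a b → Related r b c → Related r a c
  total : ∀ a b, E a x → E b x → Related r a b ∨ a = b ∨ Related r b a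
  least : ∀ y, (∀ a, E a y → E a x) → (∃ a, E a y) →
    ∃ a, E a y ∧ ∀ b, E b y → b ≠ a → Related r a b

/-- The structure `A` is a model of ZFC⁻, that is, of ZFC without the power set axiom, where
replacement is formulated as the collection scheme and choice as the well-ordering principle.
In the two schemes, the classes range over those that are first-order definable over the
structure with parameters from it. -/
structure ModelsZFCMinus : Prop where
  extensionality : ∀ x y : A, (∀ z, E z x ↔ E z y) → x = y
  foundation : ∀ x : A, (∃ y, E y x) → ∃ y, E y x ∧ ∀ z, E z x → ¬ E z y
  pairing : ∀ a b : A, ∃ w, IsUPair w a b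
  union : ∀ x : A, ∃ w, ∀ z, E z w ↔ ∃ y, E y x ∧ E z y
  infinity : ∃ x : A, (∃ e, E e x ∧ ∀ z, ¬ E z e) ∧
    ∀ y, E y x → ∃ w, E w x ∧ ∀ z, E z w ↔ E z y ∨ z = y
  separation : ∀ D : Set A, Set.Definable₁ Set.univ LSet D →
    ∀ x : A, ∃ w, ∀ z, E z w ↔ E z x ∧ z ∈ D
  collection : ∀ R : Set (A × A), Set.Definable₂ Set.univ LSet R →
    ∀ x : A, (∀ a, E a x → ∃ b, (a, b) ∈ R) → ∃ w, ∀ a, E a x → ∃ b, E b w ∧ (a, b) ∈ R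
  wellOrdering : ∀ x : A, ∃ r, WellOrders r x

end LSet

/-! ### Filter extension property, critical points, closure -/

/-- The cardinal `c` as an element of the universe of sets: its initial von Neumann ordinal. -/
noncomputable def Cardinal.toZFSet (c : Cardinal.{u}) : ZFSet.{u} := c.ord.toZFSet

/-- `κ` has the `μ`-filter extension property: every (proper) `κ`-complete filter on `μ` extends
to a `κ`-complete ultrafilter. -/
def FilterExtensionProperty (κ μ : Cardinal.{u}) : Prop :=
  ∀ F : Filter μ.ord.ToType, F.NeBot → CardinalInterFilter F κ →
    ∃ U : Ultrafilter μ.ord.ToType,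
      (U : Filter μ.ord.ToType) ≤ F ∧ CardinalInterFilter (U : Filter μ.ord.ToType) κ

/-- `^κ M ⊆ M`: every function from `κ` to `M` is an element of `M`. -/
def ClosedUnderSeq (κ : Cardinal.{u}) (M : ZFSet.{u}) : Prop :=
  ZFSet.funs κ.toZFSet M ⊆ M

/-- `crit(j) = κ`: `κ` is the least ordinal of `M` that is moved by `j`. -/
def HasCriticalPoint {M N : ZFSet.{u}} (j : M ↪ₑ[LSet] N) (κ : Cardinal.{u}) : Prop :=
  IsLeast {α : Ordinal.{u} | ∃ x : M, (x : ZFSet.{u}) = α.toZFSet ∧ (j x : ZFSet.{u}) ≠ x} κ.ord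

/-- `N ⊨ |s| < k`, for a transitive set `N` and `s, k ∈ N` such that `k` is a cardinal in `N`:
some `f ∈ N` is a bijection from `s` onto some ordinal `β < k`. -/
def InnerCardLT (N s k : ZFSet.{u}) : Prop :=
  ∃ β ∈ k, ∃ f ∈ N, ZFSet.IsFunc s β f ∧ ∀ w ∈ β, ∃! z, ZFSet.pair z w ∈ f

-- Write μ for the λ of the statement. From the filter property to embeddings, the heart is
-- compactness. Since μ^{<κ} = μ, a set of size μ has 2^μ subsets that are independent in groups of
-- fewer than κ (`exists_independent_family`). Each propositional variable becomes one such subset,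
-- a theory satisfiable in pieces smaller than κ becomes a κ-complete filter, and an extending
-- ultrafilter becomes a truth assignment (`FilterExtensionProperty.compactness`). Completeness of
-- that filter uses regularity of κ, itself a consequence of the filter property
-- (`FilterExtensionProperty.isRegular`).
--
-- The variables are formulas evaluated at terms. The terms have a constant for each element of M
-- and names s, f, b for a set, a bijection and an ordinal below κ; they are closed under Skolem
-- functions and κ-sequences, and there are at most 2^μ of them because (2^μ)^κ = 2^μ. Every actual
-- triple (s, f, b) in M gives an evaluation. The theory says that every constant lies in s; it is
-- satisfiable in small pieces because M is closed under κ-sequences. The assignment agrees with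
-- some evaluation on any fewer than κ instances, so it acts like an ultrapower (`TermModel`):
-- membership is well founded, Skolem terms give Łoś's theorem, and sequence terms give closure of
-- the collapse N. Ordinals below κ are fixed by the same local agreement, while κ moves because s
-- covers j``κ and has size below j(κ) (`exists_embedding`).
--
-- Conversely, given a filter F, take a transitive M of size 2^μ, elementarily embedded in the
-- universe, containing all subsets of μ and the family of the sets Y ∪ {g(Y)} for Y in F, with
-- distinct tags g(Y) in [μ, 2^μ). By κ-completeness, the members of F tagged by a set of size below
-- κ have a common point. Applying j to this fact and using the cover s, which contains every
-- j(g(Y)), yields a point a of j(μ) in j(Y) for all Y in F. The sets Y with a ∈ j(Y) form the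
-- required ultrafilter (`exists_ultrafilter`).

universe w

/-- The universe of sets, regarded as the structure `(V, ∈)`. -/
instance ZFSet.universeStructureLSet : LSet.Structure ZFSet.{u} where
  funMap f := nomatch f
  RelMap | .mem => fun x => x 0 ∈ x 1

/-! ### Properties given by first-order formulas, and their transfer -/

namespace LSet

open Language

theorem E_zfset {x y : ZFSet.{u}} : E x y ↔ x ∈ y := Iff.rfl

/-- A property of tuples, formulated uniformly for all structures, is expressible if it is given
by a first-order formula. -/
def Expressible {α : Type*} (P : ∀ (A : Type v) [LSet.Structure A], (α → A) → Prop) : Prop :=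
  ∃ φ : LSet.Formula α, ∀ (A : Type v) [LSet.Structure A] (w : α → A), φ.Realize w ↔ P A w

theorem wellOrders_iff {A : Type v} [LSet.Structure A] {r x : A} : WellOrders r x ↔
    (∀ a, E a x → ¬ Related r a a) ∧
    (∀ a b c, E a x → E b x → E c x → Related r a b → Related r b c → Related r a c) ∧
    (∀ a b, E a x → E b x → Related r a b ∨ a = b ∨ Related r b a) ∧
    ∀ y, (∀ a, E a y → E a x) → (∃ a, E a y) →
      ∃ a, E a y ∧ ∀ b, E b y → b ≠ a → Related r a b :=
  ⟨fun h => ⟨h.1, h.2, h.3, h.4⟩, fun h => ⟨h.1, h.2.1, h.2.2.1, h.2.2.2⟩⟩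

namespace Expressible

variable {α β : Type*} {P Q : ∀ (A : Type v) [LSet.Structure A], (α → A) → Prop}

theorem mem (i j : α) : Expressible.{v} fun _ _ w => E (w i) (w j) :=
  ⟨memSymb.formula₂ (Term.var i) (Term.var j), fun _ _ w => by
    simp [Formula.realize_rel₂, E]⟩

theorem eq (i j : α) : Expressible.{v} fun _ _ w => w i = w j :=
  ⟨(Term.var i).equal (Term.var j), fun A _ w => by simp⟩

/-- Lets an arbitrary given formula be plugged in, as needed for the separation and collection
schemes. -/
theorem formula (φ : LSet.Formula β) {f : ∀ A : Type v, (α → A) → β → A} (g : β → α)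
    (hf : ∀ A w b, f A w b = w (g b)) : Expressible fun A _ w => φ.Realize (f A w) :=
  ⟨φ.relabel g, fun A _ w => by
    rw [Formula.realize_relabel, iff_iff_eq]
    congr 1
    funext b
    exact (hf A w b).symm⟩

theorem not (hP : Expressible P) : Expressible fun A _ w => ¬ P A w := by
  obtain ⟨φ, h⟩ := hP
  exact ⟨φ.not, fun A _ w => by rw [Formula.realize_not, h]⟩

theorem and (hP : Expressible P) (hQ : Expressible Q) :
    Expressible fun A _ w => P A w ∧ Q A w := by
  obtain ⟨φ, h⟩ := hP
  obtain ⟨ψ, h'⟩ := hQ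
  exact ⟨φ ⊓ ψ, fun A _ w => by rw [Formula.realize_inf, h, h']⟩

theorem or (hP : Expressible P) (hQ : Expressible Q) :
    Expressible fun A _ w => P A w ∨ Q A w := by
  obtain ⟨φ, h⟩ := hP
  obtain ⟨ψ, h'⟩ := hQ
  exact ⟨φ ⊔ ψ, fun A _ w => by rw [Formula.realize_sup, h, h']⟩

theorem imp (hP : Expressible P) (hQ : Expressible Q) :
    Expressible fun A _ w => P A w → Q A w := by
  obtain ⟨φ, h⟩ := hP
  obtain ⟨ψ, h'⟩ := hQ
  exact ⟨φ.imp ψ, fun A _ w => by rw [Formula.realize_imp, h, h']⟩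

theorem iff (hP : Expressible P) (hQ : Expressible Q) :
    Expressible fun A _ w => P A w ↔ Q A w := by
  obtain ⟨φ, h⟩ := hP
  obtain ⟨ψ, h'⟩ := hQ
  exact ⟨φ.iff ψ, fun A _ w => by rw [Formula.realize_iff, h, h']⟩

theorem all {P : ∀ (A : Type v) [LSet.Structure A], (α → A) → A → Prop}
    (hP : Expressible (α := α ⊕ Fin 1) fun A _ w => P A (fun i => w (Sum.inl i)) (w (Sum.inr 0))) :
    Expressible fun A _ w => ∀ x, P A w x := by
  obtain ⟨φ, h⟩ := hP
  refine ⟨(BoundedFormula.relabel (n := 1) (k := 0) id φ).all, fun A _ w => ?_⟩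
  rw [Formula.Realize, BoundedFormula.realize_all]
  refine forall_congr' fun x => ?_
  rw [BoundedFormula.realize_relabel]
  refine Iff.trans (iff_of_eq ?_) (h A (Sum.elim w fun _ => x))
  rw [Formula.Realize]
  congr 1
  exact Subsingleton.elim _ _

theorem ex {P : ∀ (A : Type v) [LSet.Structure A], (α → A) → A → Prop}
    (hP : Expressible (α := α ⊕ Fin 1) fun A _ w => P A (fun i => w (Sum.inl i)) (w (Sum.inr 0))) :
    Expressible fun A _ w => ∃ x, P A w x := by
  have := (all (P := fun A _ w x => ¬ P A w x) hP.not).not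
  simpa using this

theorem isUPair (i j k : α) : Expressible.{v} fun _ _ w => IsUPair (w i) (w j) (w k) := by
  unfold IsUPair
  exact all (iff (mem _ _) (or (eq _ _) (eq _ _)))

theorem isOPair (i j k : α) : Expressible.{v} fun _ _ w => IsOPair (w i) (w j) (w k) := by
  unfold IsOPair
  exact all (iff (mem _ _) (or (isUPair _ _ _) (isUPair _ _ _)))

theorem related (i j k : α) : Expressible.{v} fun _ _ w => Related (w i) (w j) (w k) := by
  unfold Related
  exact ex (and (isOPair _ _ _) (mem _ _))

theorem wellOrders (i j : α) : Expressible.{v} fun _ _ w => WellOrders (w i) (w j) := by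
  simp only [wellOrders_iff]
  refine and ?_ (and ?_ (and ?_ ?_))
  · exact all (imp (mem _ _) (not (related _ _ _)))
  · exact all (all (all (imp (mem _ _) (imp (mem _ _) (imp (mem _ _)
      (imp (related _ _ _) (imp (related _ _ _) (related _ _ _))))))))
  · exact all (all (imp (mem _ _) (imp (mem _ _) (or (related _ _ _) (or (eq _ _)
      (related _ _ _))))))
  · exact all (imp (all (imp (mem _ _) (mem _ _))) (imp (ex (mem _ _))
      (ex (and (mem _ _) (all (imp (mem _ _) (imp (not (eq _ _)) (related _ _ _))))))))

theorem map_iff (hP : Expressible P) {A B : Type v} [LSet.Structure A] [LSet.Structure B]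
    (j : A ↪ₑ[LSet] B) (w : α → A) : P B (fun i => j (w i)) ↔ P A w := by
  obtain ⟨φ, h⟩ := hP
  rw [← h, ← h]
  exact j.map_formula φ w

end Expressible

/-- `f` is a bijection from `s` onto `b`, in the sense of the structure. -/
def IsBij {A : Type v} [LSet.Structure A] (f s b : A) : Prop :=
  (∀ p, E p f → ∃ z, E z s ∧ ∃ w, E w b ∧ IsOPair p z w) ∧
  (∀ z, E z s → ∃ w, Related f z w ∧ ∀ w', Related f z w' → w' = w) ∧
  (∀ w, E w b → ∃ z, Related f z w ∧ ∀ z', Related f z' w → z' = z)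

theorem Expressible.isBij {α : Type*} (i j k : α) :
    Expressible.{v} fun _ _ w => IsBij (w i) (w j) (w k) := by
  unfold IsBij
  refine and ?_ (and ?_ ?_)
  · exact all (imp (mem _ _) (ex (and (mem _ _) (ex (and (mem _ _) (isOPair _ _ _))))))
  · exact all (imp (mem _ _) (ex (and (related _ _ _) (all (imp (related _ _ _) (eq _ _))))))
  · exact all (imp (mem _ _) (ex (and (related _ _ _) (all (imp (related _ _ _) (eq _ _))))))

/-! ### Absoluteness of pairs and bijections for transitive classes -/

/-- The map `val` identifies the structure `A` with a transitive class of sets. -/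
structure IsTransitiveClass {A : Type v} [LSet.Structure A] (val : A → ZFSet.{u}) : Prop where
  injective : Function.Injective val
  mem_iff : ∀ a b, E a b ↔ val a ∈ val b
  trans : ∀ a, ∀ z ∈ val a, ∃ b, val b = z

theorem isTransitiveClass_coe {M : ZFSet.{u}} (hM : M.IsTransitive) :
    IsTransitiveClass (Subtype.val : M → ZFSet.{u}) :=
  ⟨Subtype.val_injective, fun _ _ => Iff.rfl, fun a z hz => ⟨⟨z, hM _ a.2 hz⟩, rfl⟩⟩

theorem isTransitiveClass_id : IsTransitiveClass (id : ZFSet.{u} → ZFSet.{u}) :=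
  ⟨Function.injective_id, fun _ _ => Iff.rfl, fun _ z _ => ⟨z, rfl⟩⟩

namespace IsTransitiveClass

variable {A : Type v} [LSet.Structure A] {val : A → ZFSet.{u}}

theorem ext_E (h : IsTransitiveClass val) {x y : A} (hxy : ∀ z, E z x ↔ E z y) : x = y := by
  apply h.injective
  ext z
  constructor
  · intro hz
    obtain ⟨b, rfl⟩ := h.trans _ _ hz
    exact (h.mem_iff _ _).1 ((hxy b).1 ((h.mem_iff _ _).2 hz))
  · intro hz
    obtain ⟨b, rfl⟩ := h.trans _ _ hz
    exact (h.mem_iff _ _).1 ((hxy b).2 ((h.mem_iff _ _).2 hz))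

theorem wellFounded_E (h : IsTransitiveClass val) : WellFounded (E : A → A → Prop) := by
  have : (E : A → A → Prop) = InvImage (· ∈ ·) val := by
    funext a b
    exact propext (h.mem_iff a b)
  rw [this]
  exact InvImage.wf _ ZFSet.mem_wf

theorem isUPair_iff (h : IsTransitiveClass val) {w a b : A} :
    IsUPair w a b ↔ val w = {val a, val b} := by
  constructor
  · intro hw
    ext z
    rw [ZFSet.mem_pair]
    constructor
    · intro hz
      obtain ⟨c, rfl⟩ := h.trans _ _ hz
      rcases (hw c).1 ((h.mem_iff _ _).2 hz) with rfl | rfl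
      · exact Or.inl rfl
      · exact Or.inr rfl
    · rintro (rfl | rfl)
      · exact (h.mem_iff _ _).1 ((hw a).2 (Or.inl rfl))
      · exact (h.mem_iff _ _).1 ((hw b).2 (Or.inr rfl))
  · intro hw c
    rw [h.mem_iff, hw, ZFSet.mem_pair, h.injective.eq_iff, h.injective.eq_iff]

/-- Pairing is what makes the forward direction work: if `{a}` or `{a, b}` were missing from the
structure, the internal condition could hold of a `p` lacking that member. -/
theorem isOPair_iff (h : IsTransitiveClass val) (hp : ∀ a b : A, ∃ w, IsUPair w a b) {p a b : A} :
    IsOPair p a b ↔ val p = ZFSet.pair (val a) (val b) := by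
  unfold IsOPair ZFSet.pair
  constructor
  · intro hw
    ext z
    rw [ZFSet.mem_pair]
    constructor
    · intro hz
      obtain ⟨c, rfl⟩ := h.trans _ _ hz
      have := (hw c).1 ((h.mem_iff _ _).2 hz)
      rwa [h.isUPair_iff, h.isUPair_iff, ZFSet.pair_eq_singleton] at this
    · rintro (rfl | rfl)
      · obtain ⟨w, hw'⟩ := hp a a
        have := (h.mem_iff _ _).1 ((hw w).2 (Or.inl hw'))
        rwa [h.isUPair_iff.1 hw', ZFSet.pair_eq_singleton] at this
      · obtain ⟨w, hw'⟩ := hp a b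
        have := (h.mem_iff _ _).1 ((hw w).2 (Or.inr hw'))
        rwa [h.isUPair_iff.1 hw'] at this
  · intro hw c
    rw [h.mem_iff, hw, ZFSet.mem_pair, h.isUPair_iff, h.isUPair_iff, ZFSet.pair_eq_singleton]

theorem related_iff (h : IsTransitiveClass val) (hp : ∀ a b : A, ∃ w, IsUPair w a b) {r a b : A} :
    Related r a b ↔ ZFSet.pair (val a) (val b) ∈ val r := by
  constructor
  · rintro ⟨p, hp', hr⟩
    rw [← (h.isOPair_iff hp).1 hp']
    exact (h.mem_iff _ _).1 hr
  · intro hr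
    obtain ⟨p, hp'⟩ := h.trans _ _ hr
    exact ⟨p, (h.isOPair_iff hp).2 hp', (h.mem_iff _ _).2 (hp' ▸ hr)⟩

theorem exists_isOPair (hp : ∀ a b : A, ∃ w, IsUPair w a b) (h : IsTransitiveClass val) (a b : A) :
    ∃ p, IsOPair p a b := by
  obtain ⟨w, hw⟩ := hp a a
  obtain ⟨w', hw'⟩ := hp a b
  obtain ⟨p, hp'⟩ := hp w w'
  rw [h.isUPair_iff] at hw hw' hp'
  refine ⟨p, (h.isOPair_iff hp).2 ?_⟩
  rw [hp', hw, hw', ZFSet.pair, ZFSet.pair_eq_singleton]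

theorem exists_val_of_pair_mem (h : IsTransitiveClass val) {r : A} {x y : ZFSet.{u}}
    (hr : ZFSet.pair x y ∈ val r) : (∃ a, val a = x) ∧ ∃ b, val b = y := by
  obtain ⟨p, hp⟩ := h.trans _ _ hr
  obtain ⟨w, hw⟩ := h.trans p {x, y} (by rw [hp, ZFSet.pair, ZFSet.mem_pair]; exact Or.inr rfl)
  exact ⟨h.trans w x (by rw [hw, ZFSet.mem_pair]; exact Or.inl rfl),
    h.trans w y (by rw [hw, ZFSet.mem_pair]; exact Or.inr rfl)⟩

theorem isBij_iff (h : IsTransitiveClass val) (hp : ∀ a b : A, ∃ w, IsUPair w a b) {f s b : A} :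
    IsBij f s b ↔ ZFSet.IsFunc (val s) (val b) (val f) ∧
      ∀ w ∈ val b, ∃! z, ZFSet.pair z w ∈ val f := by
  unfold IsBij ZFSet.IsFunc
  rw [and_assoc]
  refine and_congr ?_ (and_congr ?_ ?_)
  · constructor
    · intro H x hx
      obtain ⟨p, rfl⟩ := h.trans _ _ hx
      obtain ⟨z, hz, w, hw, hzw⟩ := H p ((h.mem_iff _ _).2 hx)
      rw [ZFSet.mem_prod]
      exact ⟨_, (h.mem_iff _ _).1 hz, _, (h.mem_iff _ _).1 hw, (h.isOPair_iff hp).1 hzw⟩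
    · intro H p hx
      obtain ⟨x, hx, y, hy, hxy⟩ := ZFSet.mem_prod.1 (H ((h.mem_iff _ _).1 hx))
      obtain ⟨z, rfl⟩ := h.trans _ _ hx
      obtain ⟨w, rfl⟩ := h.trans _ _ hy
      exact ⟨z, (h.mem_iff _ _).2 hx, w, (h.mem_iff _ _).2 hy, (h.isOPair_iff hp).2 hxy⟩
  · constructor
    · intro H x hx
      obtain ⟨z, rfl⟩ := h.trans _ _ hx
      obtain ⟨w, hw, hu⟩ := H z ((h.mem_iff _ _).2 hx)
      refine ⟨val w, (h.related_iff hp).1 hw, fun y hy => ?_⟩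
      obtain ⟨y, rfl⟩ := (h.exists_val_of_pair_mem hy).2
      rw [hu y ((h.related_iff hp).2 hy)]
    · intro H z hz
      obtain ⟨w, hw, hu⟩ := H _ ((h.mem_iff _ _).1 hz)
      obtain ⟨w, rfl⟩ := (h.exists_val_of_pair_mem hw).2
      exact ⟨w, (h.related_iff hp).2 hw, fun y hy => h.injective (hu _ ((h.related_iff hp).1 hy))⟩
  · constructor
    · intro H x hx
      obtain ⟨z, rfl⟩ := h.trans _ _ hx
      obtain ⟨w, hw, hu⟩ := H z ((h.mem_iff _ _).2 hx)
      refine ⟨val w, (h.related_iff hp).1 hw, fun y hy => ?_⟩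
      obtain ⟨y, rfl⟩ := (h.exists_val_of_pair_mem hy).1
      rw [hu y ((h.related_iff hp).2 hy)]
    · intro H z hz
      obtain ⟨w, hw, hu⟩ := H _ ((h.mem_iff _ _).1 hz)
      obtain ⟨w, rfl⟩ := (h.exists_val_of_pair_mem hw).1
      exact ⟨w, (h.related_iff hp).2 hw, fun y hy => h.injective (hu _ ((h.related_iff hp).1 hy))⟩

end IsTransitiveClass

/-! ### ZFC⁻ in elementary substructures of the universe -/

theorem exists_isUPair_zfset (a b : ZFSet.{u}) : ∃ w, IsUPair w a b :=
  ⟨{a, b}, fun _ => ZFSet.mem_pair⟩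

theorem related_zfset {r a b : ZFSet.{u}} : Related r a b ↔ ZFSet.pair a b ∈ r :=
  isTransitiveClass_id.related_iff exists_isUPair_zfset

theorem isOPair_zfset {p a b : ZFSet.{u}} : IsOPair p a b ↔ p = ZFSet.pair a b :=
  isTransitiveClass_id.isOPair_iff exists_isUPair_zfset

theorem exists_wellOrders_zfset (x : ZFSet.{u}) : ∃ r, WellOrders r x := by
  let r := ZFSet.sep (fun p => ∃ a b, p = ZFSet.pair a b ∧ WellOrderingRel a b) (ZFSet.prod x x)
  have hr : ∀ a b, E a x → E b x → (Related r a b ↔ WellOrderingRel a b) := by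
    intro a b ha hb
    rw [related_zfset, ZFSet.mem_sep, ZFSet.pair_mem_prod]
    constructor
    · rintro ⟨-, c, d, h, h'⟩
      obtain ⟨rfl, rfl⟩ := ZFSet.pair_inj.1 h
      exact h'
    · exact fun h => ⟨⟨ha, hb⟩, a, b, rfl, h⟩
  refine ⟨r, ?_, ?_, ?_, ?_⟩
  · intro a ha h
    exact irrefl_of WellOrderingRel a ((hr a a ha ha).1 h)
  · intro a b c ha hb hc h h'
    rw [hr _ _ ha hb] at h
    rw [hr _ _ hb hc] at h'
    rw [hr _ _ ha hc]
    exact trans_of WellOrderingRel h h'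
  · intro a b ha hb
    rw [hr _ _ ha hb, hr _ _ hb ha]
    exact trichotomous_of WellOrderingRel a b
  · intro y hy hne
    obtain ⟨a, ha, hmin⟩ := (IsWellFounded.wf : WellFounded (WellOrderingRel (α := ZFSet.{u}))
      ).has_min {a | E a y} hne
    refine ⟨a, ha, fun b hb hba => ?_⟩
    rw [hr _ _ (hy a ha) (hy b hb)]
    rcases trichotomous_of WellOrderingRel a b with h | h | h
    · exact h
    · exact absurd h.symm hba
    · exact absurd h (hmin b hb)

/-- An elementary substructure of the universe of sets is a model of ZFC⁻. -/
theorem modelsZFCMinus_of_elementary {A : Type (u + 1)} [LSet.Structure A]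
    (j : A ↪ₑ[LSet] ZFSet.{u}) : ModelsZFCMinus A where
  extensionality x y h := by
    have := (Expressible.map_iff (α := Fin 2) (P := fun _ _ w => (∀ z, E z (w 0) ↔ E z (w 1)))
      (.all (.iff (.mem _ _) (.mem _ _))) j ![x, y]).2 h
    exact j.injective (ZFSet.ext this)
  foundation x := by
    refine (Expressible.map_iff (α := Fin 1) (P := fun _ _ w => (∃ y, E y (w 0)) →
      ∃ y, E y (w 0) ∧ ∀ z, E z (w 0) → ¬ E z y)
      (.imp (.ex (.mem _ _)) (.ex (.and (.mem _ _) (.all (.imp (.mem _ _) (.not (.mem _ _)))))))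
      j ![x]).1 ?_
    rintro ⟨y, hy⟩
    obtain ⟨z, hz, hmin⟩ := ZFSet.mem_wf.has_min {y | y ∈ j x} ⟨y, hy⟩
    exact ⟨z, hz, fun w hw => hmin w hw⟩
  pairing a b := (Expressible.map_iff (α := Fin 2) (P := fun _ _ w => ∃ x, IsUPair x (w 0) (w 1))
      (.ex (.isUPair _ _ _)) j ![a, b]).1 (exists_isUPair_zfset _ _)
  union x := (Expressible.map_iff (α := Fin 1)
      (P := fun _ _ w => ∃ y, ∀ z, E z y ↔ ∃ t, E t (w 0) ∧ E z t)
      (.ex (.all (.iff (.mem _ _) (.ex (.and (.mem _ _) (.mem _ _)))))) j ![x]).1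
      ⟨ZFSet.sUnion (j x), fun _ => ZFSet.mem_sUnion⟩
  infinity := (Expressible.map_iff (α := Fin 0)
      (P := fun _ _ _ => ∃ x, (∃ e, E e x ∧ ∀ z, ¬ E z e) ∧
        ∀ y, E y x → ∃ w, E w x ∧ ∀ z, E z w ↔ E z y ∨ z = y)
      (.ex (.and (.ex (.and (.mem _ _) (.all (.not (.mem _ _))))) (.all (.imp (.mem _ _)
        (.ex (.and (.mem _ _) (.all (.iff (.mem _ _) (.or (.mem _ _) (.eq _ _)))))))))) j ![]).1
      ⟨ZFSet.omega, ⟨∅, ZFSet.omega_zero, ZFSet.notMem_empty⟩, fun y hy =>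
        ⟨insert y y, ZFSet.omega_succ hy, fun z => by
          simp only [E_zfset, ZFSet.mem_insert_iff, or_comm]⟩⟩
  separation D hD x := by
    obtain ⟨φ, hφ⟩ := Set.definable_iff_exists_formula_sum.1 hD
    have key : ∀ z : A, z ∈ D ↔ φ.Realize (Sum.elim (fun a : (Set.univ : Set A) => (a : A))
        ![z]) := fun z => (Set.ext_iff.1 hφ ![z])
    obtain ⟨y, hy⟩ := (Expressible.map_iff (α := Option (Set.univ : Set A))
      (P := fun B _ w => ∃ y, ∀ z, E z y ↔ E z (w none) ∧
        φ.Realize (Sum.elim (fun a => w (some a)) fun _ => z : _ → B))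
      (.ex (.all (.iff (.mem _ _) (.and (.mem _ _) (.formula φ
        (Sum.elim (fun a => Sum.inl (Sum.inl (some a))) Sum.inr) (by
          rintro B w (b | b)
          · rfl
          · rw [Fin.fin_one_eq_zero b]; rfl)))))) j (fun o => o.elim x Subtype.val)).1
      ⟨ZFSet.sep (fun z => φ.Realize (Sum.elim (fun a => j a) fun _ => z)) (j x),
        fun z => by simp only [E_zfset, ZFSet.mem_sep]; rfl⟩
    refine ⟨y, fun z => (hy z).trans (and_congr Iff.rfl ((iff_of_eq ?_).trans (key z).symm))⟩
    congr 1
    funext b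
    rcases b with b | b
    · rfl
    · rw [Fin.fin_one_eq_zero b]; rfl
  collection R hR x hx := by
    obtain ⟨φ, hφ⟩ := Set.definable_iff_exists_formula_sum.1 hR
    have key : ∀ z t : A, (z, t) ∈ R ↔ φ.Realize (Sum.elim
        (fun a : (Set.univ : Set A) => (a : A)) ![z, t]) :=
      fun z t => (Set.ext_iff.1 hφ ![z, t])
    obtain ⟨y, hy⟩ := (Expressible.map_iff (α := Option (Set.univ : Set A))
      (P := fun B _ w => (∀ z, E z (w none) → ∃ t, φ.Realize
          (Sum.elim (fun a => w (some a)) (fun i => if i = 0 then z else t) : _ → B)) →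
        ∃ y, ∀ z, E z (w none) → ∃ t, E t y ∧ φ.Realize
          (Sum.elim (fun a => w (some a)) (fun i => if i = 0 then z else t) : _ → B))
      (.imp (.all (.imp (.mem _ _) (.ex (.formula φ
        (Sum.elim (fun a => Sum.inl (Sum.inl (some a))) fun i => if i = 0 then Sum.inl (Sum.inr 0)
          else Sum.inr 0) (by
          rintro B w (b | b)
          · rfl
          · fin_cases b <;> rfl))))) (.ex (.all (.imp (.mem _ _) (.ex (.and (.mem _ _)
        (.formula φ (Sum.elim (fun a => Sum.inl (Sum.inl (Sum.inl (some a))))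
          fun i => if i = 0 then Sum.inl (Sum.inr 0) else Sum.inr 0) (by
          rintro B w (b | b)
          · rfl
          · fin_cases b <;> rfl)))))))) j (fun o => o.elim x Subtype.val)).1 (by
        intro H
        choose f hf using fun z : (j x : ZFSet.{u}) => H z z.2
        exact ⟨ZFSet.range f, fun z hz => ⟨f ⟨z, hz⟩, ZFSet.mem_range_self _, hf ⟨z, hz⟩⟩⟩)
      (by
        intro z hz
        obtain ⟨t, ht⟩ := hx z hz
        refine ⟨t, (iff_of_eq ?_).1 ((key z t).1 ht)⟩
        congr 1
        funext b
        rcases b with b | b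
        · rfl
        · fin_cases b <;> rfl)
    refine ⟨y, fun z hz => ?_⟩
    obtain ⟨t, ht, h⟩ := hy z hz
    refine ⟨t, ht, (key z t).2 ((iff_of_eq ?_).1 h)⟩
    congr 1
    funext b
    rcases b with b | b
    · rfl
    · fin_cases b <;> rfl
  wellOrdering x := (Expressible.map_iff (α := Fin 1) (P := fun _ _ w => ∃ r, WellOrders r (w 0))
      (.ex (.wellOrders _ _)) j ![x]).1 (exists_wellOrders_zfset _)

/-! ### Term models, their collapse, and Łoś's theorem -/

/-- An instance of a formula: a formula together with values for its variables. -/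
abbrev Inst (T : Type u) : Type u := Σ k, LSet.BoundedFormula ℕ k × (ℕ → T) × (Fin k → T)

/-- The instance `c` holds in `A` if the terms are evaluated by `e`. -/
def Inst.Holds {T : Type u} {A : Type v} [LSet.Structure A] (c : Inst T) (e : T → A) : Prop :=
  c.2.1.Realize (e ∘ c.2.2.1) (e ∘ c.2.2.2)

/-- The instance `a ∈ b`. -/
def memInst {T : Type u} (a b : T) : Inst T :=
  ⟨0, memSymb.boundedFormula₂ (Term.var (Sum.inl 0)) (Term.var (Sum.inl 1)),
    fun n => if n = 0 then a else b, Fin.elim0⟩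

/-- The instance `a = b`. -/
def eqInst {T : Type u} (a b : T) : Inst T :=
  ⟨0, (Term.var (Sum.inl 0)).bdEqual (Term.var (Sum.inl 1)),
    fun n => if n = 0 then a else b, Fin.elim0⟩

@[simp]
theorem memInst_holds {T : Type u} {A : Type v} [LSet.Structure A] {a b : T} {e : T → A} :
    (memInst a b).Holds e ↔ E (e a) (e b) := by
  simp [Inst.Holds, memInst, BoundedFormula.realize_rel₂, E]

@[simp]
theorem eqInst_holds {T : Type u} {A : Type v} [LSet.Structure A] {a b : T} {e : T → A} :
    (eqInst a b).Holds e ↔ e a = e b := by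
  simp [Inst.Holds, eqInst]

/-- A family of evaluations of the terms in `T` in the structure `A`, admitting Skolem terms,
together with a choice `W` of the true instances, each fewer than `κ` of which are decided
correctly by one of the evaluations. -/
structure TermModel (A : Type v) [LSet.Structure A] (I : Type w) (T : Type u)
    (κ : Cardinal.{u}) where
  /-- the evaluations -/
  ev : I → T → A
  /-- the true instances -/
  W : Inst T → Prop
  uncountable : ℵ₀ < κ
  nonempty : Nonempty T
  ext : ∀ x y : A, (∀ z, E z x ↔ E z y) → x = y
  wf : WellFounded (E : A → A → Prop)
  skolem : ∀ k (φ : LSet.BoundedFormula ℕ (k + 1)) (v : ℕ → T) (xs : Fin k → T), ∃ t, ∀ i,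
    φ.Realize (ev i ∘ v) (Fin.snoc (ev i ∘ xs) (ev i t)) →
      ∀ y, φ.Realize (ev i ∘ v) (Fin.snoc (ev i ∘ xs) y)
  realize : ∀ C : Set (Inst T), #C < κ → ∃ i, ∀ c ∈ C, W c ↔ c.Holds (ev i)

namespace TermModel

variable {A : Type v} [LSet.Structure A] {I : Type w} {T : Type u} {κ : Cardinal.{u}}
  (Y : TermModel A I T κ)

theorem realize_pair (c d : Inst T) :
    ∃ i, (Y.W c ↔ c.Holds (Y.ev i)) ∧ (Y.W d ↔ d.Holds (Y.ev i)) := by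
  obtain ⟨i, hi⟩ := Y.realize {c, d} (lt_trans (Set.Finite.lt_aleph0 (Set.toFinite _))
    Y.uncountable)
  exact ⟨i, hi _ (by simp), hi _ (by simp)⟩

theorem realize_triple (c d e : Inst T) :
    ∃ i, (Y.W c ↔ c.Holds (Y.ev i)) ∧ (Y.W d ↔ d.Holds (Y.ev i)) ∧
      (Y.W e ↔ e.Holds (Y.ev i)) := by
  obtain ⟨i, hi⟩ := Y.realize {c, d, e} (lt_trans (Set.Finite.lt_aleph0 (Set.toFinite _))
    Y.uncountable)
  exact ⟨i, hi _ (by simp), hi _ (by simp), hi _ (by simp)⟩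

theorem W_congr {c d : Inst T} (h : ∀ i, c.Holds (Y.ev i) ↔ d.Holds (Y.ev i)) :
    Y.W c ↔ Y.W d := by
  obtain ⟨i, h1, h2⟩ := Y.realize_pair c d
  rw [h1, h2, h]

/-- The membership relation between terms. -/
def R (a b : T) : Prop := Y.W (memInst a b)

/-- The equality relation between terms. -/
def Eqv (a b : T) : Prop := Y.W (eqInst a b)

theorem Eqv.symm {Y : TermModel A I T κ} {a b : T} (h : Y.Eqv a b) : Y.Eqv b a :=
  (Y.W_congr fun i => by simp [eq_comm]).1 h

theorem Eqv.left {Y : TermModel A I T κ} {a b c : T} (h : Y.Eqv a b) (h' : Y.R a c) :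
    Y.R b c := by
  obtain ⟨i, h1, h2, h3⟩ := Y.realize_triple (eqInst a b) (memInst a c) (memInst b c)
  have e := h1.1 h
  have m := h2.1 h'
  refine h3.2 ?_
  simp only [memInst_holds, eqInst_holds] at *
  exact e ▸ m

theorem Eqv.right {Y : TermModel A I T κ} {a b c : T} (h : Y.Eqv a b) (h' : Y.R c a) :
    Y.R c b := by
  obtain ⟨i, h1, h2, h3⟩ := Y.realize_triple (eqInst a b) (memInst c a) (memInst c b)
  have e := h1.1 h
  have m := h2.1 h'
  refine h3.2 ?_
  simp only [memInst_holds, eqInst_holds] at *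
  exact e ▸ m

/-- A descending chain involves only countably many instances, so a single evaluation would realize
all of it inside `A`. -/
theorem wellFounded_R : WellFounded Y.R := by
  rw [wellFounded_iff_isEmpty_descending_chain]
  refine ⟨fun ⟨f, hf⟩ => ?_⟩
  obtain ⟨i, hi⟩ := Y.realize (Set.range fun n => memInst (f (n + 1)) (f n))
    (lt_of_le_of_lt (Set.countable_range _).le_aleph0 Y.uncountable)
  refine (wellFounded_iff_isEmpty_descending_chain.1 Y.wf).false
    ⟨fun n => Y.ev i (f n), fun n => ?_⟩
  exact memInst_holds.1 ((hi _ ⟨n, rfl⟩).1 (hf n))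

/-- The transitive collapse of the membership relation between terms. -/
noncomputable def collapse : T → ZFSet.{u} :=
  Y.wellFounded_R.fix fun b ih => ZFSet.range fun a : {a // Y.R a b} => ih a.1 a.2

theorem mem_collapse {x : ZFSet.{u}} {b : T} :
    x ∈ Y.collapse b ↔ ∃ a, Y.R a b ∧ Y.collapse a = x := by
  rw [collapse, WellFounded.fix_eq, ZFSet.mem_range]
  simp only [Subtype.exists, exists_prop]

theorem collapse_eq_of_eqv {a b : T} (h : Y.Eqv a b) : Y.collapse a = Y.collapse b := by
  ext x
  rw [mem_collapse, mem_collapse]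
  exact exists_congr fun c => and_congr_left fun _ => ⟨h.right, h.symm.right⟩

/-- Extensionality passes to the terms because a Skolem term `t` names an element on which `a` and
`b` differ whenever they are distinct; by induction the collapse detects this difference. -/
theorem eqv_of_collapse_eq (a : T) : ∀ b, Y.collapse a = Y.collapse b → Y.Eqv a b := by
  induction a using Y.wellFounded_R.induction with
  | _ a ih =>
    intro b hab
    by_contra hne
    obtain ⟨t, ht⟩ := Y.skolem 0
      ((memSymb.boundedFormula₂ (Term.var (Sum.inr 0)) (Term.var (Sum.inl 0))).iff
        (memSymb.boundedFormula₂ (Term.var (Sum.inr 0)) (Term.var (Sum.inl 1))))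
      (fun n => if n = 0 then a else b) Fin.elim0
    have key : ¬ (Y.R t a ↔ Y.R t b) := by
      obtain ⟨i, h1, h2, h3⟩ := Y.realize_triple (eqInst a b) (memInst t a) (memInst t b)
      rw [R, R, h2, h3, memInst_holds, memInst_holds]
      intro h
      refine hne (h1.2 (eqInst_holds.2 (Y.ext _ _ fun z => ?_)))
      have := ht i (by
        rw [BoundedFormula.realize_iff, BoundedFormula.realize_rel₂, BoundedFormula.realize_rel₂]
        exact h) z
      rw [BoundedFormula.realize_iff, BoundedFormula.realize_rel₂,
        BoundedFormula.realize_rel₂] at this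
      exact this
    refine key ⟨fun h => ?_, fun h => ?_⟩
    · obtain ⟨t', ht', e⟩ := Y.mem_collapse.1 (hab ▸ Y.mem_collapse.2 ⟨t, h, rfl⟩)
      exact (ih t h t' e.symm).symm.left ht'
    · obtain ⟨t', ht', e⟩ := Y.mem_collapse.1 (hab.symm ▸ Y.mem_collapse.2 ⟨t, h, rfl⟩)
      exact (ih t' ht' t e).left ht'

theorem collapse_eq_iff {a b : T} : Y.collapse a = Y.collapse b ↔ Y.Eqv a b :=
  ⟨Y.eqv_of_collapse_eq a b, Y.collapse_eq_of_eqv⟩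

theorem collapse_mem_iff {a b : T} : Y.collapse a ∈ Y.collapse b ↔ Y.R a b := by
  rw [mem_collapse]
  constructor
  · rintro ⟨c, hc, e⟩
    exact (Y.collapse_eq_iff.1 e).left hc
  · exact fun h => ⟨a, h, rfl⟩

/-- The transitive set obtained by collapsing the terms. -/
noncomputable def N : ZFSet.{u} := ZFSet.range Y.collapse

/-- The element of the transitive set that is denoted by a term. -/
noncomputable def π (t : T) : Y.N := ⟨Y.collapse t, ZFSet.mem_range_self t⟩

theorem π_surjective : Function.Surjective Y.π := by
  rintro ⟨x, hx⟩
  obtain ⟨t, rfl⟩ := ZFSet.mem_range.1 hx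
  exact ⟨t, rfl⟩

theorem isTransitive_N : Y.N.IsTransitive := by
  intro x hx y hy
  obtain ⟨t, rfl⟩ := ZFSet.mem_range.1 hx
  obtain ⟨a, -, rfl⟩ := Y.mem_collapse.1 hy
  exact ZFSet.mem_range_self a

theorem card_N_le : Y.N.card ≤ #T := by
  have := ZFSet.lift_card_range_le (f := Y.collapse)
  rwa [lift_id, lift_id] at this

/-- Łoś's theorem. -/
theorem realize_iff_W {k : ℕ} (φ : LSet.BoundedFormula ℕ k) (v : ℕ → T) (xs : Fin k → T) :
    φ.Realize (Y.π ∘ v) (Y.π ∘ xs) ↔ Y.W ⟨k, φ, v, xs⟩ := by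
  have hterm : ∀ {k} (t : LSet.Term (ℕ ⊕ Fin k)), ∃ x, t = Term.var x := by
    intro k t
    cases t with
    | var x => exact ⟨x, rfl⟩
    | func f _ => exact nomatch f
  have hval : ∀ {B : Type _} (e : T → B) {k} (v : ℕ → T) (xs : Fin k → T) (x : ℕ ⊕ Fin k),
      Sum.elim (e ∘ v) (e ∘ xs) x = e (Sum.elim v xs x) := by
    rintro B e k v xs (x | x) <;> rfl
  have hval' : ∀ {k} (v : ℕ → T) (xs : Fin k → T) (x : ℕ ⊕ Fin k),
      Sum.elim (Y.π ∘ v) (Y.π ∘ xs) x = Y.π (Sum.elim v xs x) := by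
    rintro k v xs (x | x) <;> rfl
  induction φ with
  | falsum =>
    refine iff_of_false (fun h => h) fun h => ?_
    obtain ⟨i, hi, -⟩ := Y.realize_pair ⟨_, BoundedFormula.falsum, v, xs⟩
      ⟨_, BoundedFormula.falsum, v, xs⟩
    exact hi.1 h
  | equal t₁ t₂ =>
    obtain ⟨x, rfl⟩ := hterm t₁
    obtain ⟨y, rfl⟩ := hterm t₂
    refine Iff.trans (Iff.trans ?_ (Y.collapse_eq_iff (a := Sum.elim v xs x)
      (b := Sum.elim v xs y))) (Y.W_congr fun i => ?_)
    · rw [BoundedFormula.Realize, Term.realize_var, Term.realize_var, hval', hval']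
      exact Subtype.ext_iff
    · rw [eqInst_holds, Inst.Holds, BoundedFormula.Realize, Term.realize_var, Term.realize_var,
        hval, hval]
  | rel S ts =>
    cases S
    obtain ⟨x, hx⟩ := hterm (ts 0)
    obtain ⟨y, hy⟩ := hterm (ts 1)
    have hts : ts = ![Term.var x, Term.var y] := by
      funext i
      fin_cases i
      · exact hx
      · exact hy
    subst hts
    refine Iff.trans (Iff.trans ?_ (Y.collapse_mem_iff (a := Sum.elim v xs x)
      (b := Sum.elim v xs y))) (Y.W_congr fun i => ?_)
    · have : ∀ z, Sum.elim (Y.π ∘ v) (Y.π ∘ xs) z = Y.π (Sum.elim v xs z) := hval' v xs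
      change ((Sum.elim (Y.π ∘ v) (Y.π ∘ xs) x : Y.N) : ZFSet) ∈
        ((Sum.elim (Y.π ∘ v) (Y.π ∘ xs) y : Y.N) : ZFSet) ↔ _
      rw [this, this]
      exact Iff.rfl
    · rw [memInst_holds, ← hval (Y.ev i), ← hval (Y.ev i)]
      exact (BoundedFormula.realize_rel₂ (R := memSymb) (t₁ := Term.var x)
        (t₂ := Term.var y) (v := Y.ev i ∘ v) (xs := Y.ev i ∘ xs)).symm
  | imp φ ψ ihφ ihψ =>
    refine BoundedFormula.realize_imp.trans ((imp_congr (ihφ xs) (ihψ xs)).trans ?_)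
    obtain ⟨i, h1, h2, h3⟩ := Y.realize_triple ⟨_, φ, v, xs⟩ ⟨_, ψ, v, xs⟩ ⟨_, φ.imp ψ, v, xs⟩
    rw [h1, h2, h3]
    exact BoundedFormula.realize_imp.symm
  | all φ ih =>
    rw [BoundedFormula.realize_all]
    have snoc : ∀ {B : Type _} (e : T → B) {k} (xs : Fin k → T) (t : T),
        e ∘ (Fin.snoc xs t : Fin (k + 1) → T) = Fin.snoc (e ∘ xs) (e t) := fun e _ _ _ =>
      Fin.comp_snoc e _ _
    have snoc' : ∀ {k} (xs : Fin k → T) (t : T),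
        Y.π ∘ (Fin.snoc xs t : Fin (k + 1) → T) = Fin.snoc (Y.π ∘ xs) (Y.π t) := fun _ _ =>
      Fin.comp_snoc Y.π _ _
    constructor
    · intro h
      by_contra hW
      -- `t` denotes a counterexample to `φ` whenever one exists, so truth at `t` alone gives the
      -- universal statement.
      obtain ⟨t, ht⟩ := Y.skolem _ φ v xs
      obtain ⟨i, h1, h2⟩ := Y.realize_pair ⟨_, φ.all, v, xs⟩ ⟨_, φ, v, Fin.snoc xs t⟩
      refine hW (h1.2 ?_)
      rw [Inst.Holds, BoundedFormula.realize_all]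
      have := h (Y.π t)
      rw [← snoc'] at this
      have := h2.1 ((ih (Fin.snoc xs t)).1 this)
      rw [Inst.Holds, snoc] at this
      exact ht i this
    · intro h a
      obtain ⟨t, rfl⟩ := Y.π_surjective a
      rw [← snoc']
      refine (ih (Fin.snoc xs t)).2 ?_
      obtain ⟨i, h1, h2⟩ := Y.realize_pair ⟨_, φ.all, v, xs⟩ ⟨_, φ, v, Fin.snoc xs t⟩
      have := h1.1 h
      rw [Inst.Holds, BoundedFormula.realize_all] at this
      rw [h2, Inst.Holds, snoc]
      exact this _

end TermModel

namespace TermModel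

variable {A : Type (u + 1)} [LSet.Structure A] {I : Type w} {T : Type u} {κ : Cardinal.{u}}
  (Y : TermModel A I T κ)

theorem isTransitiveClass_N : IsTransitiveClass (Subtype.val : Y.N → ZFSet.{u}) :=
  isTransitiveClass_coe Y.isTransitive_N

/-- Fewer than `κ` true instances of an expressible property hold simultaneously under one of the
evaluations. -/
theorem exists_realize {α : Type} [Countable α]
    {P : ∀ (A : Type (u + 1)) [LSet.Structure A], (α → A) → Prop} (hP : Expressible P) {ι : Type u}
    (hι : #ι < κ) (v : ι → α → T) (h : ∀ k, P Y.N fun n => Y.π (v k n)) :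
    ∃ i, ∀ k, P A fun n => Y.ev i (v k n) := by
  obtain ⟨φ, hφ⟩ := hP
  obtain ⟨e, he⟩ := exists_injective_nat α
  obtain ⟨t₀⟩ := Y.nonempty
  -- Instances carry valuations on all of `ℕ`: the variables are coded by `e`, and the unused
  -- numbers get the dummy term `t₀`.
  have hv : ∀ {B : Type _} (f : T → B) k,
      (f ∘ Function.extend e (v k) fun _ => t₀) ∘ e = fun n => f (v k n) := by
    intro B f k
    funext n
    simp [he.extend_apply]
  obtain ⟨i, hi⟩ := Y.realize (Set.range fun k => ⟨0, φ.relabel e,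
    Function.extend e (v k) fun _ => t₀, Fin.elim0⟩) (lt_of_le_of_lt mk_range_le hι)
  refine ⟨i, fun k => ?_⟩
  have h1 := hi _ ⟨k, rfl⟩
  rw [← Y.realize_iff_W, Inst.Holds, Subsingleton.elim (Y.π ∘ Fin.elim0) default,
    Subsingleton.elim (Y.ev i ∘ Fin.elim0) default] at h1
  have h2 : (φ.relabel e).Realize (Y.π ∘ Function.extend e (v k) fun _ => t₀) := by
    rw [Formula.realize_relabel, hv, hφ]
    exact h k
  have h3 : (φ.relabel e).Realize (Y.ev i ∘ Function.extend e (v k) fun _ => t₀) := h1.1 h2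
  rwa [Formula.realize_relabel, hv, hφ] at h3

/-- An expressible property that holds under all evaluations is true. -/
theorem of_forall {α : Type} [Countable α]
    {P : ∀ (A : Type (u + 1)) [LSet.Structure A], (α → A) → Prop} (hP : Expressible P) (v : α → T)
    (h : ∀ i, P A fun n => Y.ev i (v n)) : P Y.N fun n => Y.π (v n) := by
  by_contra hN
  obtain ⟨i, hi⟩ := Y.exists_realize hP.not (ι := PUnit)
    (by rw [mk_punit]; exact one_lt_aleph0.trans Y.uncountable) (fun _ => v) fun _ => hN
  exact hi ⟨⟩ (h i)

theorem pairing (hA : ∀ a b : A, ∃ x, IsUPair x a b) (a b : Y.N) : ∃ x, IsUPair x a b := by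
  obtain ⟨s, rfl⟩ := Y.π_surjective a
  obtain ⟨t, rfl⟩ := Y.π_surjective b
  exact Y.of_forall (α := Fin 2) (P := fun _ _ w => ∃ x, IsUPair x (w 0) (w 1))
    (.ex (.isUPair _ _ _)) ![s, t] fun _ => hA _ _

/-- If constants for the elements of `κ` are given and `κ` is an element of the collapse, then the
collapse is closed under `κ`-sequences as soon as there are terms for sequences of terms. -/
theorem closedUnderSeq (hA : ∀ a b : A, ∃ x, IsUPair x a b)
    (hsep : ∀ g h : A, ∃ g', ∀ p, E p g' ↔ E p g ∧ ∃ a, E a h ∧ ∃ b, IsOPair p a b)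
    (hpair : ∀ p a b a' b' : A, IsOPair p a b → IsOPair p a' b' → a = a' ∧ b = b')
    (c : κ.ord.ToType → T) (hc : ∀ i, Function.Injective fun α => Y.ev i (c α))
    (hcπ : ∀ x : ZFSet.{u}, x ∈ κ.toZFSet ↔ ∃ α, (Y.π (c α) : ZFSet.{u}) = x)
    (hκ : κ.toZFSet ∈ Y.N)
    (hseq : ∀ t : κ.ord.ToType → T, ∃ q, ∀ i z, E z (Y.ev i q) ↔
      ∃ α, IsOPair z (Y.ev i (c α)) (Y.ev i (t α))) :
    ClosedUnderSeq κ Y.N := by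
  intro f hf
  rw [ZFSet.mem_funs] at hf
  have hN := Y.isTransitiveClass_N
  have hp := Y.pairing hA
  have : ∀ α, ∃ t, ZFSet.pair (Y.π (c α)) (Y.π t) ∈ f := by
    intro α
    obtain ⟨y, hy, -⟩ := hf.2 (Y.π (c α)) ((hcπ _).2 ⟨α, rfl⟩)
    obtain ⟨t, ht⟩ := Y.π_surjective ⟨y, (ZFSet.pair_mem_prod.1 (hf.1 hy)).2⟩
    exact ⟨t, by rwa [ht]⟩
  choose t ht using this
  obtain ⟨q, hq⟩ := hseq t
  obtain ⟨h, hh⟩ := Y.π_surjective ⟨_, hκ⟩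
  -- In the collapse, `q` may denote a sequence longer than `κ`, as with j(κ) in place of `κ`. It is
  -- cut down to the pairs with first coordinate in `κ`; this is where `κ` must belong to the
  -- collapse.
  obtain ⟨g, hg⟩ := Y.of_forall (α := Fin 2)
    (P := fun _ _ w => ∃ g', ∀ p, E p g' ↔ E p (w 0) ∧ ∃ a, E a (w 1) ∧ ∃ b, IsOPair p a b)
    (.ex (.all (.iff (.mem _ _) (.and (.mem _ _) (.ex (.and (.mem _ _) (.ex (.isOPair _ _ _))))))))
    ![q, h] fun _ => hsep _ _
  replace hg : ∀ p, E p g ↔ E p (Y.π q) ∧ ∃ a, E a (Y.π h) ∧ ∃ b, IsOPair p a b := hg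
  suffices f = g by rw [this]; exact g.2
  have hmem : ∀ α p, IsOPair p (Y.π (c α)) (Y.π (t α)) → E p (Y.π q) := by
    intro α p hpα
    obtain ⟨p, rfl⟩ := Y.π_surjective p
    refine Y.of_forall (α := Fin 4) (P := fun _ _ w => IsOPair (w 0) (w 1) (w 2) → E (w 0) (w 3))
      (.imp (.isOPair _ _ _) (.mem _ _)) ![p, c α, t α, q] (fun i => ?_) hpα
    exact fun H => (hq i _).2 ⟨α, H⟩
  have hval : ∀ α p r, IsOPair p (Y.π (c α)) r → E p (Y.π q) → r = Y.π (t α) := by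
    intro α p r
    obtain ⟨p, rfl⟩ := Y.π_surjective p
    obtain ⟨r, rfl⟩ := Y.π_surjective r
    refine Y.of_forall (α := Fin 5)
      (P := fun _ _ w => IsOPair (w 0) (w 1) (w 2) → E (w 0) (w 3) → w 2 = w 4)
      (.imp (.isOPair _ _ _) (.imp (.mem _ _) (.eq _ _))) ![p, c α, r, q, t α] (fun i => ?_)
    intro H H'
    obtain ⟨β, hβ⟩ := (hq i _).1 H'
    obtain ⟨h1, h2⟩ := hpair _ _ _ _ _ H hβ
    rw [hc i h1]
    exact h2
  ext z
  constructor
  · intro hz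
    obtain ⟨x, hx, y, -, rfl⟩ := ZFSet.mem_prod.1 (hf.1 hz)
    obtain ⟨α, rfl⟩ := (hcπ x).1 hx
    rw [(hf.2 _ hx).unique hz (ht α)]
    obtain ⟨p, hp'⟩ := hN.exists_isOPair hp (Y.π (c α)) (Y.π (t α))
    rw [← (hN.isOPair_iff hp).1 hp']
    exact (hN.mem_iff _ _).1 ((hg p).2 ⟨hmem α p hp', Y.π (c α),
      by rw [hh]; exact (hcπ _).2 ⟨α, rfl⟩, Y.π (t α), hp'⟩)
  · intro hz
    obtain ⟨p, rfl⟩ := hN.trans _ _ hz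
    obtain ⟨hpq, a, ha, b, hab⟩ := (hg p).1 hz
    rw [hh] at ha
    obtain ⟨α, hα⟩ := (hcπ _).1 ha
    obtain rfl : Y.π (c α) = a := Subtype.ext hα
    rw [(hN.isOPair_iff hp).1 hab, hval α p b hab hpq]
    exact ht α

end TermModel
-- Counting instances and terms
instance countable_boundedFormula : Countable (Σ k, LSet.BoundedFormula ℕ k) := by
  rw [← mk_le_aleph0_iff]
  refine BoundedFormula.card_le.trans ?_
  have : Countable LSet.Symbols := by
    have h1 : Countable (Σ l, LSet.Functions l) := by
      have : IsEmpty (Σ l, LSet.Functions l) := ⟨fun x => (x.2 : Empty).elim⟩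
      infer_instance
    have h2 : Countable (Σ l, LSet.Relations l) :=
      Function.Injective.countable (f := fun x => x.1) fun ⟨_, .mem⟩ ⟨_, .mem⟩ _ => rfl
    exact inferInstanceAs (Countable ((Σ l, LSet.Functions l) ⊕ (Σ l, LSet.Relations l)))
  have : LSet.card ≤ ℵ₀ := mk_le_aleph0_iff.2 this
  simpa using this

theorem mk_inst_le {T : Type u} {θ : Cardinal.{u}} (hT : #T ≤ θ) (hω : ℵ₀ ≤ θ)
    (hθ : θ ^ ℵ₀ = θ) : #(Inst T) ≤ θ := by
  rw [mk_sigma]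
  have : ∀ k, #(LSet.BoundedFormula ℕ k × (ℕ → T) × (Fin k → T)) ≤ θ := by
    intro k
    have h1 : #(LSet.BoundedFormula ℕ k) ≤ ℵ₀ := by
      have : Countable (LSet.BoundedFormula ℕ k) :=
        (sigma_mk_injective (β := fun k => LSet.BoundedFormula ℕ k) (i := k)).countable
      exact mk_le_aleph0_iff.2 this
    simp only [mk_prod, mk_pi, prod_const, lift_id, mk_fin, mk_nat, lift_aleph0, lift_natCast,
      lift_uzero]
    refine mul_le_of_le hω ((lift_le.2 h1).trans (by simpa using hω)) (mul_le_of_le hω ?_ ?_)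
    · exact (power_le_power_right hT).trans hθ.le
    · exact (power_le_power_right hT).trans (power_nat_le hω)
  refine (sum_le_sum _ _ this).trans ?_
  rw [sum_const]
  refine mul_le_of_le hω ?_ (by simp)
  simpa using hω

/-- The shapes of the nodes of a hull term: constants, Skolem functions, and sequences. -/
inductive HullShape (B : Type u) : Type u
  | base (b : B)
  | skolem (k : ℕ) (φ : LSet.BoundedFormula ℕ (k + 1))
  | seq

/-- The arity of a node of a hull term. -/
def HullShape.Arity {B : Type u} (K : Type u) : HullShape B → Type u
  | base _ => PEmpty
  | skolem k _ => ULift (ℕ ⊕ Fin k)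
  | seq => K

theorem mk_hullShape_le {B : Type u} {θ : Cardinal.{u}} (hB : #B ≤ θ) (hω : ℵ₀ ≤ θ) :
    #(HullShape B) ≤ θ := by
  let f : HullShape B → B ⊕ Option (Σ k, LSet.BoundedFormula ℕ k)
    | .base b => Sum.inl b
    | .skolem k φ => Sum.inr (some ⟨k + 1, φ⟩)
    | .seq => Sum.inr none
  have hf : Function.Injective f := by
    rintro (b | ⟨k, φ⟩ | _) (b' | ⟨k', φ'⟩ | _) h
    all_goals simp only [f, Sum.inl.injEq, Sum.inr.injEq, reduceCtorEq, Option.some.injEq,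
      Sigma.mk.injEq, Nat.add_right_cancel_iff] at h
    · rw [h]
    · obtain ⟨rfl, h⟩ := h
      rw [eq_of_heq h]
    · rfl
  refine (mk_le_of_injective hf).trans ?_
  rw [mk_sum]
  refine add_le_of_le hω (by simpa using hB) ?_
  have : #(Option (Σ k, LSet.BoundedFormula ℕ k)) ≤ ℵ₀ := mk_le_aleph0_iff.2 inferInstance
  exact (lift_le.2 this).trans (by simpa using hω)

theorem mk_wType_hullShape_le {B K : Type u} {θ : Cardinal.{u}} (hB : #B ≤ θ) (hω : ℵ₀ ≤ θ)
    (hθ : θ ^ ℵ₀ = θ) (hK : θ ^ #K = θ) :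
    #(WType (HullShape.Arity K : HullShape B → Type u)) ≤ θ := by
  refine WType.cardinalMk_le_of_le ?_
  have : ∀ a : HullShape B, θ ^ #(a.Arity K) ≤ θ := by
    rintro (b | ⟨k, φ⟩ | _)
    · simpa [HullShape.Arity] using one_le_aleph0.trans hω
    · have : #(ULift.{u} (ℕ ⊕ Fin k)) = ℵ₀ := by simp
      change θ ^ #(ULift.{u} (ℕ ⊕ Fin k)) ≤ θ
      rw [this, hθ]
    · exact hK.le
  refine (sum_le_sum _ _ this).trans ?_
  rw [sum_const, lift_id, lift_id]
  exact mul_le_of_le hω (mk_hullShape_le hB hω) le_rfl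

/-- There are few terms denoting given families of elements of a structure such that Skolem terms
and terms for sequences exist. -/
theorem exists_terms {A : Type v} [LSet.Structure A] {I : Type w} [Nonempty A] {B K : Type u}
    [Nonempty B] {θ : Cardinal.{u}} (hB : #B ≤ θ) (hω : ℵ₀ ≤ θ) (hθ : θ ^ ℵ₀ = θ)
    (hK : θ ^ #K = θ) (base : B → I → A) (sq : (K → A) → A) :
    ∃ (T : Type u) (ev : I → T → A), Nonempty T ∧ #T ≤ θ ∧
      (∃ c : B → T, ∀ b i, ev i (c b) = base b i) ∧
      (∀ k (φ : LSet.BoundedFormula ℕ (k + 1)) (v : ℕ → T) (xs : Fin k → T), ∃ t, ∀ i,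
        φ.Realize (ev i ∘ v) (Fin.snoc (ev i ∘ xs) (ev i t)) →
          ∀ y, φ.Realize (ev i ∘ v) (Fin.snoc (ev i ∘ xs) y)) ∧
      ∀ t : K → T, ∃ q, ∀ i, ev i q = sq fun α => ev i (t α) := by
  have hsk : ∀ k (φ : LSet.BoundedFormula ℕ (k + 1)) (w : ULift.{u} (ℕ ⊕ Fin k) → A), ∃ a,
      φ.Realize (fun n => w ⟨Sum.inl n⟩)
        (Fin.snoc (fun n => w ⟨Sum.inr n⟩) a : Fin (k + 1) → A) →
      ∀ y, φ.Realize (fun n => w ⟨Sum.inl n⟩)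
        (Fin.snoc (fun n => w ⟨Sum.inr n⟩) y : Fin (k + 1) → A) := by
    intro k φ w
    by_cases h : ∀ y, φ.Realize (fun n => w ⟨Sum.inl n⟩)
        (Fin.snoc (fun n => w ⟨Sum.inr n⟩) y : Fin (k + 1) → A)
    · exact ⟨Classical.arbitrary A, fun _ => h⟩
    · obtain ⟨y, hy⟩ := not_forall.1 h
      exact ⟨y, fun h' => absurd h' hy⟩
  choose sk hsk using hsk
  -- Only the base constants depend on the index `i`. Skolem functions and sequences are computed
  -- pointwise, so one term serves all evaluations.
  let step : I → (Σ a : HullShape B, a.Arity K → A) → A := fun i x =>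
    match x with
    | ⟨.base b, _⟩ => base b i
    | ⟨.skolem k φ, f⟩ => sk k φ f
    | ⟨.seq, f⟩ => sq f
  refine ⟨WType (HullShape.Arity K : HullShape B → Type u), fun i => WType.elim A (step i),
    ⟨WType.mk (.base (Classical.arbitrary B)) PEmpty.elim⟩, mk_wType_hullShape_le hB hω hθ hK,
    ⟨fun b => WType.mk (.base b) PEmpty.elim, fun b i => rfl⟩, fun k φ v xs => ?_, fun t => ?_⟩
  · exact ⟨WType.mk (.skolem k φ) fun x => Sum.elim v xs x.down, fun i =>
      hsk k φ fun x => WType.elim A (step i) (Sum.elim v xs x.down)⟩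
  · exact ⟨WType.mk .seq t, fun i => rfl⟩

end LSet

/-! ### Regularity, independent families, and infinitary compactness -/

section

open Filter Set

variable {κ μ : Cardinal.{u}}

/-- The filter extension property holds for filters on any set of the given size. -/
theorem FilterExtensionProperty.exists_ultrafilter (h : FilterExtensionProperty κ μ) {D : Type u}
    (hD : #D = μ) (F : Filter D) [F.NeBot] [CardinalInterFilter F κ] :
    ∃ U : Ultrafilter D, (U : Filter D) ≤ F ∧ CardinalInterFilter (U : Filter D) κ := by
  obtain ⟨e⟩ : Nonempty (D ≃ μ.ord.ToType) := Cardinal.eq.1 (by rw [hD, mk_ord_toType])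
  obtain ⟨U, hU, hU'⟩ := h (F.map e) inferInstance inferInstance
  refine ⟨U.map e.symm, ?_, ?_⟩
  · have := map_mono (m := e.symm) hU
    rwa [Filter.map_map, Equiv.symm_comp_self, Filter.map_id] at this
  · rw [Ultrafilter.coe_map]
    infer_instance

/-- If `κ` were singular, a `κ`-complete ultrafilter would also be closed under intersections of `κ`
sets. One extending the image of the co-`κ` filter on κ⁺ contains no singleton, yet deciding each of
the `κ` bits of κ⁺ distinct subsets of `κ` would isolate at most one point. -/
theorem FilterExtensionProperty.isRegular (h : FilterExtensionProperty κ μ) (hκ : ℵ₀ < κ)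
    (hκμ : κ ≤ μ) (hμ : μ ^< κ = μ) : κ.IsRegular := by
  refine IsRegular.of_not_isSingular hκ.le fun hs => ?_
  have hcof := hs.cof_ord_lt
  -- König's theorem gives κ < κ^{cf κ}, which excludes `κ = μ` when `κ` is singular.
  have hlt : κ < μ := by
    refine lt_of_le_of_ne hκμ ?_
    rintro rfl
    exact absurd (le_powerlt κ hcof) (by rw [hμ]; exact not_le.2 (lt_power_cof_ord hκ.le))
  let D := μ.ord.ToType
  let L := (Order.succ κ).ord.ToType
  let K := κ.ord.ToType
  have hreg := isRegular_succ hκ.le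
  obtain ⟨e⟩ : Nonempty (L ↪ D) := by
    rw [← Cardinal.le_def, mk_ord_toType, mk_ord_toType]
    exact Order.succ_le_of_lt hlt
  obtain ⟨g⟩ : Nonempty (L ↪ Set K) := by
    rw [← Cardinal.le_def, mk_set, mk_ord_toType, mk_ord_toType]
    exact Order.succ_le_of_lt (cantor κ)
  have hne : (cocardinal L hreg).NeBot := by
    rw [neBot_iff, Ne, ← empty_mem_iff_bot, mem_cocardinal, compl_empty, mk_univ, mk_ord_toType]
    exact lt_irrefl _
  have : CardinalInterFilter (map e (cocardinal L hreg)) κ :=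
    CardinalInterFilter.of_cardinalInterFilter_of_le _ (Order.le_succ κ)
  obtain ⟨U, hU, hUκ⟩ := h.exists_ultrafilter (mk_ord_toType μ) (map e (cocardinal L hreg))
  -- A cofinal set of fewer than `κ` indices splits the intersection into initial segments, each of
  -- size below `κ`.
  have key : ∀ s : K → Set D, (∀ ξ, s ξ ∈ U) → ⋂ ξ, s ξ ∈ U := by
    intro s hs'
    obtain ⟨S, hS, hS'⟩ := Order.exists_cof_eq K
    rw [Ordinal.cof_toType] at hS'
    have h1 : ⋂ ν : S, ⋂ ξ : Iic (ν : K), s ξ ∈ (U : Filter D) := by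
      rw [cardinal_iInter_mem (c := κ) (by rw [hS']; exact hcof)]
      intro ν
      rw [cardinal_iInter_mem (c := κ)]
      · exact fun ξ => hs' ξ
      · have := mk_Iic_lt (ν : K) (by simp [K]) (by rw [mk_ord_toType]; exact hκ.le)
        rwa [mk_ord_toType] at this
    refine mem_of_superset h1 fun d hd => mem_iInter.2 fun ξ => ?_
    obtain ⟨ν, hν, hξ⟩ := hS ξ
    exact mem_iInter.1 (mem_iInter.1 hd ⟨ν, hν⟩) ⟨ξ, hξ⟩
  let A : K → Set D := fun ξ => {d | ∃ l, e l = d ∧ ξ ∈ g l}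
  let s : K → Set D := fun ξ => {d | d ∈ A ξ ↔ A ξ ∈ U}
  have hs' : ∀ ξ, s ξ ∈ U := by
    intro ξ
    by_cases hA : A ξ ∈ U
    · exact mem_of_superset hA fun d hd => iff_of_true hd hA
    · exact mem_of_superset (U.compl_mem_iff_notMem.2 hA) fun d hd => iff_of_false hd hA
  have hmem : range e ∩ ⋂ ξ, s ξ ∈ U :=
    inter_mem (hU (image_univ ▸ image_mem_map univ_mem)) (key s hs')
  obtain ⟨_, ⟨l₀, rfl⟩, hl₀⟩ := U.nonempty_of_mem hmem
  have hcompl : {e l₀}ᶜ ∈ U := by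
    refine hU (mem_map.2 (mem_cocardinal.2 ?_))
    refine lt_of_le_of_lt (mk_le_mk_of_subset (t := {l₀}) fun l hl => ?_) ?_
    · exact e.injective (by simpa using hl)
    · rw [mk_singleton]
      exact one_lt_aleph0.trans (hκ.trans (Order.lt_succ κ))
  obtain ⟨_, ⟨⟨l, rfl⟩, hl⟩, hne'⟩ := U.nonempty_of_mem (inter_mem hmem hcompl)
  refine hne' (congrArg e (g.injective ?_))
  have hA : ∀ ξ l, e l ∈ A ξ ↔ ξ ∈ g l := fun ξ l =>
    ⟨fun ⟨l', h1, h2⟩ => e.injective h1 ▸ h2, fun h => ⟨l, rfl, h⟩⟩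
  ext ξ
  rw [← hA, ← hA]
  exact (mem_iInter.1 hl ξ).trans (mem_iInter.1 hl₀ ξ).symm

theorem Cardinal.mk_subsets_lt_le {L : Type u} (hL : #L ≤ μ) (hκ : ℵ₀ < κ) (hκμ : κ ≤ μ)
    (hμ : μ ^< κ = μ) : #{a : Set L // #a < κ} ≤ μ := by
  let c : κ.ord.ToType → Cardinal := fun ν => (Ordinal.typein (α := κ.ord.ToType) (· < ·) ν).card
  have h1 : {a : Set L | #a < κ} ⊆ ⋃ ν, {a : Set L | #a ≤ c ν} := by
    intro a ha
    refine mem_iUnion.2 ⟨Ordinal.enum (α := κ.ord.ToType) (· < ·) ⟨(#a).ord, ?_⟩, ?_⟩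
    · rw [mem_Iio, Ordinal.type_toType]
      exact ord_lt_ord.2 ha
    · rw [mem_ofPred_eq]
      exact ((card_ord _).symm.trans (congrArg Ordinal.card (Ordinal.typein_enum (α := κ.ord.ToType)
        (· < ·) _).symm)).le
  have hω : ℵ₀ ≤ μ := hκ.le.trans hκμ
  refine (mk_le_mk_of_subset h1).trans ((mk_iUnion_le _).trans ?_)
  rw [mk_ord_toType]
  refine mul_le_of_le hω hκμ (ciSup_le' fun ν => ?_)
  refine (mk_bounded_set_le L (c ν)).trans ((power_le_power_right (max_le hL hω)).trans ?_)
  conv_rhs => rw [← hμ]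
  exact le_powerlt _ (lt_ord.1 (Ordinal.typein_lt_self ν))

/-- If `μ ^< κ = μ`, then there are `2 ^ μ` subsets of `μ` that are independent with respect to
fewer than `κ` of them. -/
theorem exists_independent_family (hκ : ℵ₀ < κ) (hκμ : κ ≤ μ) (hμ : μ ^< κ = μ) {T : Type u}
    (hT : #T ≤ 2 ^ μ) : ∃ D : Type u, #D = μ ∧ ∃ A : T → Set D,
      ∀ C : Set T, #C < κ → ∀ W : T → Prop, ∃ d, ∀ c ∈ C, d ∈ A c ↔ W c := by
  let L := μ.ord.ToType
  have hL : #L = μ := mk_ord_toType μ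
  let P := {a : Set L // #a < κ}
  have hP : #P ≤ μ := mk_subsets_lt_le hL.le hκ hκμ hμ
  let Q := {a : Set P // #a < κ}
  have hQ : #Q ≤ μ := mk_subsets_lt_le hP hκ hκμ hμ
  have hω : ℵ₀ ≤ μ := hκ.le.trans hκμ
  obtain ⟨g⟩ : Nonempty (T ↪ Set L) := by
    rw [← Cardinal.le_def, mk_set, hL]
    exact hT
  have hres : ∀ (a : P) (X : Set L), #(X ∩ a.1 : Set L) < κ := fun a X =>
    lt_of_le_of_lt (mk_le_mk_of_subset inter_subset_right) a.2
  -- Hausdorff's construction: a point is a small set `a` with a small family `S` of its subsets,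
  -- and it lies in the set of `t` when the trace of `g t` on `a` belongs to `S`. The summand `L`
  -- only brings the size up to `μ`.
  refine ⟨P × Q ⊕ L, ?_, fun t => {d | ∃ a S, d = Sum.inl (a, S) ∧ ⟨g t ∩ a.1, hres a _⟩ ∈ S.1},
    fun C hC W => ?_⟩
  · simp only [mk_sum, mk_prod, lift_id, hL]
    exact le_antisymm (add_le_of_le hω (mul_le_of_le hω hP hQ) le_rfl) (self_le_add_left _ _)
  · have hsep : ∀ p : C × C, ∃ l : L, p.1 ≠ p.2 → ¬ (l ∈ g p.1 ↔ l ∈ g p.2) := by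
      rintro ⟨c, c'⟩
      have : Nonempty L := by
        rw [← mk_ne_zero_iff, hL]
        exact (aleph0_pos.trans_le hω).ne'
      by_cases hcc : c = c'
      · exact ⟨Classical.arbitrary L, fun h => absurd hcc h⟩
      · have : g c ≠ g c' := fun h => hcc (Subtype.ext (g.injective h))
        by_contra! H
        exact this (Set.ext fun l => (H l).2)
    choose l hl using hsep
    have ha : #(range l) < κ := by
      refine lt_of_le_of_lt mk_range_le ?_
      rw [mk_prod, lift_id]
      exact mul_lt_of_lt hκ.le hC hC
    let a : P := ⟨range l, ha⟩
    let S : Q := ⟨range fun c : {c : C // W c} => ⟨g c.1 ∩ a.1, hres a _⟩,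
      lt_of_le_of_lt mk_range_le ((mk_subtype_le _).trans_lt hC)⟩
    refine ⟨Sum.inl (a, S), fun c hc => ?_⟩
    constructor
    · rintro ⟨a', S', h1, h2⟩
      obtain ⟨rfl, rfl⟩ := Prod.mk.inj (Sum.inl.inj h1)
      obtain ⟨⟨c', hc'⟩, h3⟩ := h2
      have h4 : g c' ∩ a.1 = g c ∩ a.1 := congrArg Subtype.val h3
      by_contra hW
      have hne : c' ≠ ⟨c, hc⟩ := by
        rintro rfl
        exact hW hc'
      refine hl (c', ⟨c, hc⟩) hne ?_
      have h5 := Set.ext_iff.1 h4 (l (c', ⟨c, hc⟩))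
      have h6 : l (c', ⟨c, hc⟩) ∈ a.1 := ⟨_, rfl⟩
      simpa only [mem_inter_iff, h6, and_true] using h5
    · intro hW
      exact ⟨a, S, rfl, ⟨⟨⟨c, hc⟩, hW⟩, rfl⟩⟩

/-- The filter extension property implies the compactness of infinitary propositional logic for
theories in `2 ^ μ` variables. Here, `X` is a set of assignments to the variables in `T`. -/
theorem FilterExtensionProperty.compactness (h : FilterExtensionProperty κ μ) (hκ : ℵ₀ < κ)
    (hκμ : κ ≤ μ) (hμ : μ ^< κ = μ) {T : Type u} (hT : #T ≤ 2 ^ μ) {I : Type w} (X : I → T → Prop)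
    (S : Set T) (hS : ∀ C : Set T, #C < κ → ∃ i, ∀ c ∈ C, c ∈ S → X i c) :
    ∃ W : T → Prop, (∀ c ∈ S, W c) ∧ ∀ C : Set T, #C < κ → ∃ i, ∀ c ∈ C, W c ↔ X i c := by
  have hreg := h.isRegular hκ hκμ hμ
  obtain ⟨D, hD, A, hA⟩ := exists_independent_family hκ hκμ hμ hT
  -- A point `d` is read as the assignment making `c` true when `d ∈ A c`. It is in `G C` if on `C`
  -- it agrees with an admissible assignment satisfying the theory `S`.
  let G : Set T → Set D := fun C => {d | ∃ i, ∀ c ∈ C, (d ∈ A c ↔ X i c) ∧ (c ∈ S → X i c)}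
  have hG : ∀ {C C'}, C ⊆ C' → G C' ⊆ G C := fun hCC' d ⟨i, hi⟩ =>
    ⟨i, fun c hc => hi c (hCC' hc)⟩
  let F : Filter D := Filter.ofCardinalInter {Y | ∃ C : Set T, #C < κ ∧ G C ⊆ Y} (hreg.nat_lt 2)
    (by
      intro 𝒮 h𝒮 hsub
      choose C hC using fun Y : 𝒮 => hsub Y.2
      refine ⟨⋃ Y, C Y, (card_iUnion_lt_iff_forall_of_isRegular hreg h𝒮).2 fun Y => (hC Y).1, ?_⟩
      exact subset_sInter fun Y hY =>
        (hG (subset_iUnion C ⟨Y, hY⟩)).trans (hC ⟨Y, hY⟩).2)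
    (fun Y Y' ⟨C, hC, hCY⟩ hYY' => ⟨C, hC, hCY.trans hYY'⟩)
  have hF : CardinalInterFilter F κ := cardinalInter_ofCardinalInter ..
  have hGF : ∀ C : Set T, #C < κ → G C ∈ F := fun C hC => ⟨C, hC, Subset.rfl⟩
  have hFne : F.NeBot := by
    rw [neBot_iff, Ne, ← empty_mem_iff_bot]
    rintro ⟨C, hC, hempty⟩
    obtain ⟨i, hi⟩ := hS C hC
    obtain ⟨d, hd⟩ := hA C hC (X i)
    exact hempty (⟨i, fun c hc => ⟨hd c hc, hi c hc⟩⟩ : d ∈ G C)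
  obtain ⟨U, hU, hUκ⟩ := h.exists_ultrafilter hD F
  refine ⟨fun c => A c ∈ U, fun c hc => ?_, fun C hC => ?_⟩
  · refine mem_of_superset (hU (hGF {c} (by rw [mk_singleton]; exact one_lt_aleph0.trans hκ))) ?_
    rintro d ⟨i, hi⟩
    exact (hi c rfl).1.2 ((hi c rfl).2 hc)
  · have h1 : ⋂ c : C, {d | d ∈ A c ↔ A c ∈ U} ∈ (U : Filter D) := by
      rw [cardinal_iInter_mem hC]
      intro c
      by_cases hc : A c ∈ U
      · exact mem_of_superset hc fun d hd => iff_of_true hd hc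
      · exact mem_of_superset (U.compl_mem_iff_notMem.2 hc) fun d hd => iff_of_false hd hc
    obtain ⟨d, ⟨i, hi⟩, hd⟩ := U.nonempty_of_mem (inter_mem (hU (hGF C hC)) h1)
    exact ⟨i, fun c hc => ((mem_iInter.1 hd ⟨c, hc⟩).symm.trans (hi c hc).1)⟩

end

/-! ### Short sequences and small covers inside a closed model -/

namespace LSet

open Language

/-- The element of `κ.toZFSet` that corresponds to an element of `κ.ord.ToType`. -/
noncomputable def ordSet {κ : Cardinal.{u}} (α : κ.ord.ToType) : ZFSet.{u} :=
  (Ordinal.ToType.mk.symm α : Ordinal.{u}).toZFSet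

theorem mem_toZFSet_iff_ordSet {κ : Cardinal.{u}} {x : ZFSet.{u}} :
    x ∈ κ.toZFSet ↔ ∃ α : κ.ord.ToType, ordSet α = x := by
  rw [Cardinal.toZFSet, Ordinal.mem_toZFSet_iff]
  constructor
  · rintro ⟨a, ha, rfl⟩
    exact ⟨Ordinal.ToType.mk ⟨a, ha⟩, by simp [ordSet]⟩
  · rintro ⟨α, rfl⟩
    exact ⟨_, (Ordinal.ToType.mk.symm α).2, rfl⟩

theorem ordSet_injective {κ : Cardinal.{u}} : Function.Injective (ordSet (κ := κ)) := fun _ _ h =>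
  Ordinal.ToType.mk.symm.injective (Subtype.ext (Ordinal.toZFSet_injective h))

theorem isTransitive_toZFSet (κ : Cardinal.{u}) : κ.toZFSet.IsTransitive :=
  (ZFSet.isOrdinal_toZFSet _).isTransitive

theorem toZFSet_mem_toZFSet {κ μ : Cardinal.{u}} (h : κ < μ) : κ.toZFSet ∈ μ.toZFSet :=
  Ordinal.toZFSet_mem_toZFSet_iff.2 (ord_lt_ord.2 h)

/-- Separation for expressible properties with parameters. -/
theorem ModelsZFCMinus.exists_sep {A : Type v} [LSet.Structure A] (hA : ModelsZFCMinus A)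
    {β : Type*} {P : ∀ (A : Type v) [LSet.Structure A], (Option β → A) → Prop}
    (hP : Expressible P) (c : β → A) (x : A) :
    ∃ y, ∀ z, E z y ↔ E z x ∧ P A fun o => o.elim z c := by
  obtain ⟨φ, hφ⟩ := hP
  refine hA.separation {z | P A fun o => o.elim z c} ?_ x
  rw [Set.Definable₁, Set.definable_iff_exists_formula_sum]
  refine ⟨φ.relabel fun o => o.elim (Sum.inr 0) fun b => Sum.inl ⟨c b, trivial⟩, ?_⟩
  ext z
  simp only [Set.mem_ofPred_eq, Formula.realize_relabel, ← hφ]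
  rw [iff_iff_eq]
  congr 1
  funext o
  cases o <;> rfl

theorem exists_seq {M : ZFSet.{u}} {κ : Cardinal.{u}} (hMt : M.IsTransitive)
    (hM : ModelsZFCMinus M) (hMκ : ClosedUnderSeq κ M) (o : κ.ord.ToType → M)
    (ho : ∀ α, (o α : ZFSet.{u}) = ordSet α) (f : κ.ord.ToType → M) :
    ∃ q : M, ∀ z, E z q ↔ ∃ α, IsOPair z (o α) (f α) := by
  have hv := isTransitiveClass_coe hMt
  let F := ZFSet.range fun α => ZFSet.pair (o α) (f α)
  have hF : F ∈ M := by
    refine hMκ (ZFSet.mem_funs.2 ⟨fun z hz => ?_, fun z hz => ?_⟩)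
    · obtain ⟨α, rfl⟩ := ZFSet.mem_range.1 hz
      rw [ZFSet.pair_mem_prod]
      exact ⟨mem_toZFSet_iff_ordSet.2 ⟨α, (ho α).symm⟩, (f α).2⟩
    · obtain ⟨α, rfl⟩ := mem_toZFSet_iff_ordSet.1 hz
      refine ⟨f α, ZFSet.mem_range.2 ⟨α, by rw [ho]⟩, fun y hy => ?_⟩
      obtain ⟨β, hβ⟩ := ZFSet.mem_range.1 hy
      obtain ⟨h1, h2⟩ := ZFSet.pair_inj.1 hβ
      rw [ho] at h1
      rw [← h2, ordSet_injective h1]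
  refine ⟨⟨F, hF⟩, fun z => ?_⟩
  rw [hv.mem_iff, ZFSet.mem_range]
  refine exists_congr fun α => ?_
  rw [hv.isOPair_iff hM.pairing, eq_comm]

/-- A surjection from `κ` onto `R` turns the family into a `κ`-sequence; its range is separated from
the second union of the graph, where Kuratowski pairs put their coordinates. -/
theorem exists_range {M : ZFSet.{u}} {κ : Cardinal.{u}} (hMt : M.IsTransitive)
    (hM : ModelsZFCMinus M) (hMκ : ClosedUnderSeq κ M) (o : κ.ord.ToType → M)
    (ho : ∀ α, (o α : ZFSet.{u}) = ordSet α) {R : Type u} [Nonempty R] (hR : #R ≤ κ) (f : R → M) :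
    ∃ a : M, ∀ z, E z a ↔ ∃ r, z = f r := by
  have hv := isTransitiveClass_coe hMt
  obtain ⟨g, hg⟩ : ∃ g : κ.ord.ToType → R, Function.Surjective g := by
    rw [← mk_ord_toType κ, Cardinal.le_def] at hR
    obtain ⟨e⟩ := hR
    exact ⟨Function.invFun e, Function.invFun_surjective e.injective⟩
  obtain ⟨q, hq⟩ := exists_seq hMt hM hMκ o ho (f ∘ g)
  obtain ⟨u₁, hu₁⟩ := hM.union q
  obtain ⟨u₂, hu₂⟩ := hM.union u₁
  obtain ⟨a, ha⟩ := hM.exists_sep (β := Fin 1) (P := fun _ _ w => ∃ x, Related (w (some 0)) x (w none))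
    (.ex (.related _ _ _)) (fun _ => q) u₂
  refine ⟨a, fun z => (ha z).trans ⟨?_, ?_⟩⟩
  · rintro ⟨-, x, p, hp, hpq⟩
    obtain ⟨α, hα⟩ := (hq p).1 hpq
    have hp' : IsOPair p x z := hp
    rw [hv.isOPair_iff hM.pairing] at hα hp'
    exact ⟨g α, hv.injective (ZFSet.pair_inj.1 (hp'.symm.trans hα)).2⟩
  · rintro ⟨r, rfl⟩
    obtain ⟨α, rfl⟩ := hg r
    obtain ⟨p, hp⟩ := hv.exists_isOPair hM.pairing (o α) (f (g α))
    obtain ⟨w, hw⟩ := hM.pairing (o α) (f (g α))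
    have hpq : E p q := (hq p).2 ⟨α, hp⟩
    exact ⟨(hu₂ _).2 ⟨w, (hu₁ _).2 ⟨p, hpq, (hp w).2 (Or.inr hw)⟩, (hw _).2 (Or.inr rfl)⟩,
      o α, p, hp, hpq⟩

/-- Fewer than `κ` elements of `M` are covered by a set of cardinality less than `κ` in `M`. -/
theorem exists_cover {M : ZFSet.{u}} {κ : Cardinal.{u}} (hMt : M.IsTransitive)
    (hM : ModelsZFCMinus M) (hMκ : ClosedUnderSeq κ M) (o : κ.ord.ToType → M)
    (ho : ∀ α, (o α : ZFSet.{u}) = ordSet α) (hκ : ℵ₀ < κ) (k : M)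
    (hk : (k : ZFSet.{u}) = κ.toZFSet) {ι : Type u}
    (hι : #ι < κ) (c : ι → M) : ∃ s f b : M, E b k ∧ IsBij f s b ∧ ∀ i, E (c i) s := by
  have hv := isTransitiveClass_coe hMt
  -- The extra member `k` keeps the index type nonempty when `ι` is empty, as `exists_range`
  -- requires.
  let c' : Option ι → M := fun i => i.elim k c
  let R := Shrink.{u} (Set.range c')
  have hne : Nonempty R := ⟨equivShrink _ ⟨k, none, rfl⟩⟩
  have hR : #R < κ := by
    have h1 : #R ≤ #(Option ι) := by
      rw [← lift_le.{u + 1}, lift_mk_shrink'']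
      have := mk_range_le_lift (f := c')
      rwa [lift_id'.{u, u + 1}] at this
    refine h1.trans_lt ?_
    rw [mk_option]
    exact add_lt_of_lt hκ.le hι (one_lt_aleph0.trans hκ)
  let x : R → M := fun r => ((equivShrink _).symm r).1
  have hx : Function.Injective x := fun r r' h => (equivShrink _).symm.injective (Subtype.ext h)
  obtain ⟨e⟩ : Nonempty (R ≃ (#R).ord.ToType) := Cardinal.eq.1 (by rw [mk_ord_toType])
  have hb : (#R).toZFSet ∈ κ.toZFSet := toZFSet_mem_toZFSet hR
  have hkM : ∀ y ∈ κ.toZFSet, y ∈ M := fun y hy => hMt _ k.2 (hk ▸ hy)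
  let y : R → M := fun r => ⟨ordSet (e r), hkM _ (isTransitive_toZFSet κ _ hb
    (mem_toZFSet_iff_ordSet.2 ⟨e r, rfl⟩))⟩
  have hy : Function.Injective y := fun r r' h =>
    e.injective (ordSet_injective (congrArg Subtype.val h))
  choose p hp using fun r => hv.exists_isOPair hM.pairing (x r) (y r)
  have hpair : ∀ {p a b a' b' : M}, IsOPair p a b → IsOPair p a' b' → a = a' ∧ b = b' := by
    intro p a b a' b' h h'
    rw [hv.isOPair_iff hM.pairing] at h h'
    exact (ZFSet.pair_inj.1 (h.symm.trans h')).imp (fun h => hv.injective h)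
      (fun h => hv.injective h)
  obtain ⟨s, hs⟩ := exists_range hMt hM hMκ o ho hR.le x
  obtain ⟨f, hf⟩ := exists_range hMt hM hMκ o ho hR.le p
  have hyb : ∀ w : M, (w : ZFSet) ∈ (#R).toZFSet ↔ ∃ r, w = y r := by
    intro w
    rw [mem_toZFSet_iff_ordSet]
    constructor
    · rintro ⟨α, hα⟩
      exact ⟨e.symm α, Subtype.ext (by simp [y, hα])⟩
    · rintro ⟨r, rfl⟩
      exact ⟨_, rfl⟩
  have hrel : ∀ z w, Related f z w ↔ ∃ r, z = x r ∧ w = y r := by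
    intro z w
    constructor
    · rintro ⟨q, hq, hqf⟩
      obtain ⟨r, rfl⟩ := (hf q).1 hqf
      exact ⟨r, hpair hq (hp r)⟩
    · rintro ⟨r, rfl, rfl⟩
      exact ⟨p r, hp r, (hf _).2 ⟨r, rfl⟩⟩
  refine ⟨s, f, ⟨_, hkM _ hb⟩, ?_, ⟨?_, ?_, ?_⟩, fun i => ?_⟩
  · rw [hv.mem_iff, hk]
    exact hb
  · intro q hq
    obtain ⟨r, rfl⟩ := (hf q).1 hq
    exact ⟨x r, (hs _).2 ⟨r, rfl⟩, y r, (hyb _).2 ⟨r, rfl⟩, hp r⟩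
  · intro z hz
    obtain ⟨r, rfl⟩ := (hs z).1 hz
    refine ⟨y r, (hrel _ _).2 ⟨r, rfl, rfl⟩, fun w' hw' => ?_⟩
    obtain ⟨r', h1, h2⟩ := (hrel _ _).1 hw'
    rw [h2, hx h1]
  · intro w hw
    obtain ⟨r, rfl⟩ := (hyb w).1 hw
    refine ⟨x r, (hrel _ _).2 ⟨r, rfl, rfl⟩, fun w' hw' => ?_⟩
    obtain ⟨r', h1, h2⟩ := (hrel _ _).1 hw'
    rw [h1, hy h2]
  · exact (hs _).2 ⟨equivShrink _ ⟨c i, some i, rfl⟩, by simp [x]⟩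

theorem Expressible.isOrdinal {α : Type*} (i : α) : Expressible.{v} fun _ _ w =>
    (∀ x, E x (w i) → ∀ y, E y x → E y (w i)) ∧
      ∀ x, E x (w i) → ∀ y, E y x → ∀ z, E z y → E z x :=
  and (all (imp (mem _ _) (all (imp (mem _ _) (mem _ _)))))
    (all (imp (mem _ _) (all (imp (mem _ _) (all (imp (mem _ _) (mem _ _)))))))

theorem IsTransitiveClass.isOrdinal_iff {A : Type v} [LSet.Structure A] {val : A → ZFSet.{u}}
    (h : IsTransitiveClass val) {a : A} : (val a).IsOrdinal ↔
      (∀ x, E x a → ∀ y, E y x → E y a) ∧ ∀ x, E x a → ∀ y, E y x → ∀ z, E z y → E z x := by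
  rw [ZFSet.isOrdinal_iff_forall_mem_isTransitive]
  have key : ∀ b : A, (val b).IsTransitive ↔ ∀ x, E x b → ∀ y, E y x → E y b := by
    intro b
    constructor
    · intro H x hx y hy
      exact (h.mem_iff _ _).2 (H _ ((h.mem_iff _ _).1 hx) ((h.mem_iff _ _).1 hy))
    · intro H x hx y hy
      obtain ⟨x, rfl⟩ := h.trans _ _ hx
      obtain ⟨y, rfl⟩ := h.trans _ _ hy
      exact (h.mem_iff _ _).1 (H _ ((h.mem_iff _ _).2 hx) _ ((h.mem_iff _ _).2 hy))
  rw [key]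
  refine and_congr_right fun _ => ?_
  constructor
  · intro H x hx
    exact (key x).1 (H _ ((h.mem_iff _ _).1 hx))
  · intro H x hx
    obtain ⟨x, rfl⟩ := h.trans _ _ hx
    exact (key x).2 (H _ ((h.mem_iff _ _).2 hx))

theorem power_two_power_eq {κ μ : Cardinal.{u}} (hμ : ℵ₀ ≤ μ) (hκμ : κ ≤ μ) (hκ : κ ≠ 0) :
    ((2 : Cardinal.{u}) ^ μ) ^ κ = 2 ^ μ := by
  rw [← power_mul, mul_eq_left hμ hκμ hκ]

/-! ### The embedding obtained from compactness -/

namespace TermModel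

variable {A : Type (u + 1)} [LSet.Structure A] {I : Type w} {T : Type u} {κ : Cardinal.{u}}
  (Y : TermModel A I T κ)

/-- The elementary embedding given by constants for all elements. -/
noncomputable def embedding (c : A → T) (hc : ∀ a i, Y.ev i (c a) = a) : A ↪ₑ[LSet] Y.N where
  toFun a := Y.π (c a)
  map_formula' n φ x := by
    have h1 : ∀ i, (fun k => Y.ev i (c (x k))) = x := fun i => funext fun k => hc _ i
    have hφ : Expressible (α := Fin n) fun B _ w => φ.Realize w := ⟨φ, fun _ _ _ => Iff.rfl⟩
    constructor
    · intro h
      by_contra h'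
      exact Y.of_forall hφ.not (fun k => c (x k)) (fun i => by rwa [h1]) h
    · intro h
      exact Y.of_forall hφ (fun k => c (x k)) fun i => by rwa [h1]

/-- Constants for sets of size less than `κ` all of whose elements are fixed are fixed. -/
theorem coe_π_eq {val : A → ZFSet.{u}} (hv : IsTransitiveClass val) (c : A → T)
    (hc : ∀ a i, Y.ev i (c a) = a) (a : A) (ha : (val a).card < κ)
    (hfix : ∀ b, E b a → (Y.π (c b) : ZFSet.{u}) = val b) : (Y.π (c a) : ZFSet.{u}) = val a := by
  have hmem : ∀ b, E b a → E (Y.π (c b)) (Y.π (c a)) := by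
    intro b hb
    exact Y.of_forall (α := Fin 2) (P := fun _ _ w => E (w 0) (w 1)) (.mem _ _) ![c b, c a]
      fun i => by
        change E (Y.ev i (c b)) (Y.ev i (c a))
        rwa [hc, hc]
  ext z
  constructor
  · intro hz
    obtain ⟨t, ht⟩ := Y.isTransitiveClass_N.trans _ _ hz
    obtain ⟨t, rfl⟩ := Y.π_surjective t
    subst ht
    -- If `t` lies in the constant for `a` but differs from the constants of all its members, these
    -- are fewer than `κ` instances; some evaluation realizes them and gives an element of `a`
    -- unequal to every element of `a`.
    by_contra hne
    have hta : ¬ Y.π t = Y.π (c a) := fun h => ZFSet.mem_irrefl _ (h ▸ hz)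
    choose b hb using fun x : Shrink.{u} (val a) =>
      hv.trans a ((equivShrink (val a)).symm x).1 ((equivShrink (val a)).symm x).2
    have hba : ∀ x, E (b x) a := fun x => by
      rw [hv.mem_iff, hb]
      exact ((equivShrink (val a)).symm x).2
    obtain ⟨i, hi⟩ := Y.exists_realize (α := Fin 3) (ι := Option (Shrink.{u} (val a)))
      (P := fun _ _ w => E (w 0) (w 1) ∧ ¬ w 0 = w 2) (.and (.mem _ _) (.not (.eq _ _)))
      (by
        rw [mk_option]
        exact add_lt_of_lt Y.uncountable.le ha (one_lt_aleph0.trans Y.uncountable))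
      (fun x => ![t, c a, c (x.elim a b)]) (by
        rintro (_ | x)
        · exact ⟨hz, hta⟩
        · refine ⟨hz, fun h => hne ?_⟩
          have h' : Y.π t = Y.π (c (b x)) := h
          rw [h', hfix _ (hba x)]
          exact (hv.mem_iff _ _).1 (hba x))
    have h1 : E (Y.ev i t) (Y.ev i (c a)) := (hi none).1
    rw [hc, hv.mem_iff] at h1
    have h2 : ¬ Y.ev i t = Y.ev i (c (b (equivShrink _ ⟨_, h1⟩))) := (hi (some _)).2
    rw [hc] at h2
    exact h2 (hv.injective (by rw [hb]; simp))
  · intro hz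
    obtain ⟨b, rfl⟩ := hv.trans _ _ hz
    have hb := (hv.mem_iff _ _).2 hz
    rw [← hfix b hb]
    exact hmem b hb

end TermModel

theorem innerCardLT_iff {N : ZFSet.{u}} (hN : N.IsTransitive)
    (hp : ∀ a b : N, ∃ w, IsUPair w a b) {s k f b : N} (hbk : E b k) (h : IsBij f s b) :
    InnerCardLT N s k := by
  obtain ⟨h1, h2⟩ := ((isTransitiveClass_coe hN).isBij_iff hp).1 h
  exact ⟨b, hbk, f, f.2, h1, h2⟩

theorem card_le_of_isFunc {s b f : ZFSet.{u}} (h : ZFSet.IsFunc s b f)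
    (h' : ∀ w ∈ b, ∃! z, ZFSet.pair z w ∈ f) {K : Type u} (g : K → ZFSet.{u})
    (hg : Function.Injective g) (hgs : ∀ a, g a ∈ s) : #K ≤ b.card := by
  choose w hw hw' using fun a => h.2 (g a) (hgs a)
  have hwb : ∀ a, w a ∈ b := fun a => (ZFSet.pair_mem_prod.1 (h.1 (hw a))).2
  have : Function.Injective fun a => equivShrink b ⟨w a, hwb a⟩ := by
    intro a a' haa'
    have h1 : w a = w a' := congrArg Subtype.val ((equivShrink b).injective haa')
    exact hg ((h' _ (hwb a)).unique (hw a) (h1 ▸ hw a'))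
  exact mk_le_of_injective this

theorem exists_embedding {κ μ : Cardinal.{u}} (hκ : ℵ₀ < κ) (hκμ : κ ≤ μ) (hμ : μ ^< κ = μ)
    (h : FilterExtensionProperty κ μ) {M : ZFSet.{u}} (hMt : M.IsTransitive)
    (hM : ModelsZFCMinus M) (hμM : (2 ^ μ : Cardinal.{u}).toZFSet ⊆ M) (hcard : M.card = 2 ^ μ)
    (hMκ : ClosedUnderSeq κ M) :
    ∃ (N : ZFSet.{u}) (j : M ↪ₑ[LSet] N), N.IsTransitive ∧ HasCriticalPoint j κ ∧
      ClosedUnderSeq κ N ∧ ∃ s ∈ N, (∀ x : M, (j x : ZFSet.{u}) ∈ s) ∧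
        ∃ k : M, (k : ZFSet.{u}) = κ.toZFSet ∧ InnerCardLT N s (j k) := by
  have hv := isTransitiveClass_coe hMt
  have hω : ℵ₀ ≤ μ := hκ.le.trans hκμ
  have hω' : ℵ₀ ≤ (2 : Cardinal.{u}) ^ μ := hω.trans (cantor μ).le
  have hθω : ((2 : Cardinal.{u}) ^ μ) ^ ℵ₀ = 2 ^ μ := power_two_power_eq hω hω aleph0_ne_zero
  have hθκ : ((2 : Cardinal.{u}) ^ μ) ^ #κ.ord.ToType = 2 ^ μ := by
    rw [mk_ord_toType]
    exact power_two_power_eq hω hκμ (aleph0_pos.trans hκ).ne'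
  have hkM : κ.toZFSet ∈ M := hμM (toZFSet_mem_toZFSet (hκμ.trans_lt (cantor μ)))
  let k : M := ⟨_, hkM⟩
  have hordM : ∀ α : κ.ord.ToType, ordSet α ∈ M := fun α =>
    hMt _ hkM (mem_toZFSet_iff_ordSet.2 ⟨α, rfl⟩)
  let o : κ.ord.ToType → M := fun α => ⟨ordSet α, hordM α⟩
  have ho : ∀ α, (o α : ZFSet.{u}) = ordSet α := fun _ => rfl
  -- The possible values of the three new names: a set, a bijection, and an ordinal below `κ`.
  let I := {i : M × M × M // E i.2.2 k ∧ IsBij i.2.1 i.1 i.2.2}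
  choose sq hsq using exists_seq hMt hM hMκ o ho
  have : Nonempty M := ⟨k⟩
  let B := Shrink.{u} M ⊕ ULift.{u} (Fin 3)
  have : Nonempty B := ⟨Sum.inr ⟨0⟩⟩
  have hB : #B ≤ 2 ^ μ := by
    have h1 : #(Shrink.{u} M) ≤ 2 ^ μ := hcard.le
    have h2 : #(ULift.{u} (Fin 3)) ≤ 2 ^ μ := (lt_aleph0_of_finite _).le.trans hω'
    rw [mk_sum, lift_id, lift_id]
    exact add_le_of_le hω' h1 h2
  obtain ⟨T, ev, hTne, hT, ⟨c, hc⟩, hskolem, hseq⟩ := exists_terms (I := I) hB hω' hθω hθκ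
    (fun b i => Sum.elim (fun a => (equivShrink M).symm a)
      (fun x => ![i.1.1, i.1.2.1, i.1.2.2] x.down) b) sq
  let cM : M → T := fun a => c (Sum.inl (equivShrink M a))
  have hcM : ∀ a i, ev i (cM a) = a := fun a i => by simp [cM, hc]
  let ts : T := c (Sum.inr ⟨0⟩)
  let tf : T := c (Sum.inr ⟨1⟩)
  let tb : T := c (Sum.inr ⟨2⟩)
  have hts : ∀ i, ev i ts = i.1.1 := fun i => hc _ i
  have htf : ∀ i, ev i tf = i.1.2.1 := fun i => hc _ i
  have htb : ∀ i, ev i tb = i.1.2.2 := fun i => hc _ i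
  -- The theory puts every constant into the set named by `ts`. Fewer than `κ` of its members
  -- mention fewer than `κ` elements of `M`, which `exists_cover` handles.
  obtain ⟨W, hWS, hW⟩ := h.compactness hκ hκμ hμ (mk_inst_le hT hω' hθω)
    (fun (i : I) x => x.Holds (ev i)) (Set.range fun a => memInst (cM a) ts) (by
      intro C hC
      let ι := {x : C // ∃ a, memInst (cM a) ts = x.1}
      have hι : #ι < κ := (mk_subtype_le _).trans_lt hC
      choose a ha using fun x : ι => x.2
      obtain ⟨s, f, b, hb, hf, hs⟩ := exists_cover hMt hM hMκ o ho hκ k rfl hι a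
      refine ⟨⟨(s, f, b), hb, hf⟩, ?_⟩
      rintro x hx ⟨a', ha'⟩
      have h1 := ha ⟨⟨x, hx⟩, a', ha'⟩
      have h2 := hs ⟨⟨x, hx⟩, a', ha'⟩
      change _ = x at h1
      rw [← h1, memInst_holds, hcM, hts]
      exact h2)
  let Y : TermModel M I T κ := ⟨ev, W, hκ, hTne, fun x y hxy => hv.ext_E hxy, hv.wellFounded_E,
    hskolem, hW⟩
  have hcY : ∀ a i, Y.ev i (cM a) = a := hcM
  let j := Y.embedding cM hcY
  have hN := Y.isTransitiveClass_N
  have hp := Y.pairing hM.pairing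
  have hfix : ∀ x ∈ κ.toZFSet, ∀ a : M, (a : ZFSet.{u}) = x → (j a : ZFSet.{u}) = a := by
    intro x
    induction x using ZFSet.inductionOn with
    | _ x ih =>
      rintro hx a rfl
      refine Y.coe_π_eq hv cM hcY a ?_ fun b hb => ih b hb (isTransitive_toZFSet κ _ hx hb) b rfl
      obtain ⟨α, hα, hα'⟩ := Ordinal.mem_toZFSet_iff.1 hx
      rw [← hα', Ordinal.card_toZFSet]
      exact lt_ord.1 hα
  have hjs : ∀ a, E (j a) (Y.π ts) := fun a => Y.collapse_mem_iff.2 (hWS _ ⟨a, rfl⟩)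
  have hbij : E (Y.π tb) (j k) ∧ IsBij (Y.π tf) (Y.π ts) (Y.π tb) := by
    refine Y.of_forall (α := Fin 4) (P := fun _ _ w => E (w 2) (w 3) ∧ IsBij (w 1) (w 0) (w 2))
      (.and (.mem _ _) (.isBij _ _ _)) ![ts, tf, tb, cM k] fun i => ?_
    have := i.2
    rw [← hts i, ← htf i, ← htb i, ← hcM k i] at this
    exact this
  -- Otherwise the ordinal named by `tb` would be below `κ`, although it is in bijection with a set
  -- containing the `κ` distinct images of the ordinals below `κ`.
  have hkne : (j k : ZFSet.{u}) ≠ k := by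
    intro hjk
    obtain ⟨h1, h2⟩ := (hN.isBij_iff hp).1 hbij.2
    have h3 := card_le_of_isFunc h1 h2 (fun α => (j (o α) : ZFSet.{u})) (fun α β hαβ => by
      have := j.injective (Subtype.ext hαβ)
      exact ordSet_injective (congrArg Subtype.val this)) fun α => hjs _
    have h4 : (Y.π tb : ZFSet.{u}) ∈ κ.toZFSet := by
      have := (hN.mem_iff _ _).1 hbij.1
      rwa [hjk] at this
    obtain ⟨α, hα, hα'⟩ := Ordinal.mem_toZFSet_iff.1 h4
    rw [← hα', Ordinal.card_toZFSet, mk_ord_toType] at h3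
    exact absurd (lt_ord.1 hα) (not_lt.2 h3)
  have hjo : ∀ x ∈ κ.toZFSet, x ∈ (j k : ZFSet.{u}) := by
    intro x hx
    obtain ⟨α, rfl⟩ := mem_toZFSet_iff_ordSet.1 hx
    have h1 : (j (o α) : ZFSet.{u}) = o α := hfix _ hx (o α) rfl
    have h2 : E (j (o α)) (j k) :=
      (Expressible.map_iff (α := Fin 2) (P := fun _ _ w => E (w 0) (w 1)) (.mem _ _) j
        ![o α, k]).2 hx
    rw [hN.mem_iff, h1] at h2
    exact h2
  -- The ordinal j(κ) includes `κ` and differs from it, so `κ` is one of its elements.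
  have hkN : κ.toZFSet ∈ Y.N := by
    have h1 : (κ.toZFSet).IsOrdinal := ZFSet.isOrdinal_toZFSet _
    have h2 : (j k : ZFSet.{u}).IsOrdinal := hN.isOrdinal_iff.2
      ((Expressible.map_iff (α := Fin 1) (Expressible.isOrdinal 0) j ![k]).2
        (hv.isOrdinal_iff.1 h1))
    rcases h1.mem_trichotomous h2 with h3 | h3 | h3
    · exact Y.isTransitive_N _ (j k).2 h3
    · exact absurd h3.symm hkne
    · exact absurd (hjo _ h3) (ZFSet.mem_irrefl _)
  refine ⟨Y.N, j, Y.isTransitive_N, ⟨⟨k, rfl, hkne⟩, ?_⟩, ?_, Y.π ts, (Y.π ts).2, hjs, k, rfl,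
    innerCardLT_iff Y.isTransitive_N hp hbij.1 hbij.2⟩
  · rintro α ⟨x, hx, hjx⟩
    by_contra hα
    exact hjx (hfix x (by rw [hx]; exact Ordinal.toZFSet_mem_toZFSet_iff.2 (not_le.1 hα)) x rfl)
  · refine Y.closedUnderSeq hM.pairing ?_ ?_ (fun α => cM (o α)) ?_ ?_ hkN ?_
    · intro g h
      exact hM.exists_sep (β := Fin 1)
        (P := fun _ _ w => ∃ a, E a (w (some 0)) ∧ ∃ b, IsOPair (w none) a b)
        (.ex (.and (.mem _ _) (.ex (.isOPair _ _ _)))) (fun _ => h) g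
    · intro p a b a' b' h h'
      rw [hv.isOPair_iff hM.pairing] at h h'
      exact (ZFSet.pair_inj.1 (h.symm.trans h')).imp (fun h => hv.injective h)
        (fun h => hv.injective h)
    · intro i α β hαβ
      simp only [hcY] at hαβ
      exact ordSet_injective (congrArg Subtype.val hαβ)
    · intro x
      rw [mem_toZFSet_iff_ordSet]
      refine exists_congr fun α => ?_
      have : (Y.π (cM (o α)) : ZFSet.{u}) = ordSet α :=
        hfix _ (mem_toZFSet_iff_ordSet.2 ⟨α, rfl⟩) (o α) rfl
      rw [this]
    · intro t
      obtain ⟨q, hq⟩ := hseq t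
      refine ⟨q, fun i z => ?_⟩
      simp only [hcY]
      rw [show Y.ev i q = ev i q from rfl, hq i]
      exact hsq _ z

/-! ### Transitive hulls containing prescribed sets -/

/-- The set of ordinals below `μ` that corresponds to a subset of `μ.ord.ToType`. -/
noncomputable def code {μ : Cardinal.{u}} (Y : Set μ.ord.ToType) : ZFSet.{u} :=
  ZFSet.range fun x : Y => ordSet (x : μ.ord.ToType)

theorem mem_code {μ : Cardinal.{u}} {Y : Set μ.ord.ToType} {z : ZFSet.{u}} :
    z ∈ code Y ↔ ∃ x ∈ Y, ordSet x = z := by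
  simp [code]

theorem ordSet_mem_code {μ : Cardinal.{u}} {Y : Set μ.ord.ToType} {x : μ.ord.ToType} :
    ordSet x ∈ code Y ↔ x ∈ Y := by
  rw [mem_code]
  constructor
  · rintro ⟨x', hx', h⟩
    rwa [← ordSet_injective h]
  · exact fun h => ⟨x, h, rfl⟩

/-- Every family of at most `2 ^ μ` sets that is transitive and contains the ordinals below `2 ^ μ`
is contained in a transitive elementary substructure of the universe that has size `2 ^ μ` and is
closed under `κ`-sequences. -/
theorem exists_transitive_model {κ μ : Cardinal.{u}} (hκ : ℵ₀ < κ) (hκμ : κ ≤ μ) {B : Type u}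
    (hB : #B ≤ 2 ^ μ) (base : B → ZFSet.{u}) (htrans : ∀ b, ∀ z ∈ base b, ∃ b', base b' = z)
    (hord : ∀ x ∈ (2 ^ μ : Cardinal.{u}).toZFSet, ∃ b, base b = x) :
    ∃ (M : ZFSet.{u}) (i : M ↪ₑ[LSet] ZFSet.{u}), M.IsTransitive ∧ M.card = 2 ^ μ ∧
      ClosedUnderSeq κ M ∧ ∀ b, ∃ a : M, (a : ZFSet.{u}) = base b ∧ i a = base b := by
  have hω : ℵ₀ ≤ μ := hκ.le.trans hκμ
  have hω' : ℵ₀ ≤ (2 : Cardinal.{u}) ^ μ := hω.trans (cantor μ).le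
  have hθω : ((2 : Cardinal.{u}) ^ μ) ^ ℵ₀ = 2 ^ μ := power_two_power_eq hω hω aleph0_ne_zero
  have hθκ : ((2 : Cardinal.{u}) ^ μ) ^ #κ.ord.ToType = 2 ^ μ := by
    rw [mk_ord_toType]
    exact power_two_power_eq hω hκμ (aleph0_pos.trans hκ).ne'
  have hκθ : κ.toZFSet ∈ (2 ^ μ : Cardinal.{u}).toZFSet :=
    toZFSet_mem_toZFSet (hκμ.trans_lt (cantor μ))
  obtain ⟨bκ, hbκ⟩ := hord _ hκθ
  have hoB : ∀ α : κ.ord.ToType, ∃ b, base b = ordSet α := fun α =>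
    hord _ (isTransitive_toZFSet _ _ hκθ (mem_toZFSet_iff_ordSet.2 ⟨α, rfl⟩))
  choose ob hob using hoB
  have : Nonempty B := ⟨bκ⟩
  obtain ⟨T, ev, hTne, hT, ⟨c, hc⟩, hskolem, hseq⟩ := exists_terms (I := Unit) hB hω' hθω hθκ
    (fun b _ => base b) fun f => ZFSet.range fun α : κ.ord.ToType => ZFSet.pair (ordSet α) (f α)
  have hv := isTransitiveClass_id.{u}
  -- With one evaluation and actual truth as assignment, the term model is the Mostowski collapse of
  -- a Skolem hull closed under `κ`-sequences; the transitive base is not moved by the collapse.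
  let Y : TermModel ZFSet.{u} Unit T κ := ⟨ev, fun x => x.Holds (ev ()), hκ, hTne,
    fun x y hxy => hv.ext_E hxy, hv.wellFounded_E, hskolem, fun _ _ => ⟨(), fun _ _ => Iff.rfl⟩⟩
  have hR : ∀ {s t : T}, Y.R s t ↔ ev () s ∈ ev () t := memInst_holds
  have hEqv : ∀ {s t : T}, Y.Eqv s t ↔ ev () s = ev () t := eqInst_holds
  have hfix : ∀ x b, base b = x → (Y.π (c b) : ZFSet.{u}) = x := by
    intro x
    induction x using ZFSet.inductionOn with
    | _ x ih =>
      rintro b rfl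
      ext z
      refine Y.mem_collapse.trans ⟨?_, fun hz => ?_⟩
      · rintro ⟨t, ht, rfl⟩
        rw [hR, hc] at ht
        obtain ⟨b', hb'⟩ := htrans b _ ht
        have h1 : Y.collapse t = Y.collapse (c b') := Y.collapse_eq_iff.2 (hEqv.2 (by rw [hc, hb']))
        have h2 : Y.collapse (c b') = ev () t := ih _ ht b' hb'
        rw [h1, h2]
        exact ht
      · obtain ⟨b', hb'⟩ := htrans b z hz
        exact ⟨c b', hR.2 (by rwa [hc, hc, hb']), ih z hz b' hb'⟩
  -- Choosing a term for each element inverts the collapse; terms with equal collapse have equal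
  -- values, so the choice does not matter.
  choose t ht using Y.π_surjective
  have hevt : ∀ s, ev () (t (Y.π s)) = ev () s := fun s =>
    hEqv.1 (Y.collapse_eq_iff.1 (congrArg Subtype.val (ht (Y.π s))))
  let i : Y.N ↪ₑ[LSet] ZFSet.{u} := ⟨fun a => ev () (t a), fun n φ x => by
    have hφ : Expressible (α := Fin n) fun B _ w => φ.Realize w := ⟨φ, fun _ _ _ => Iff.rfl⟩
    have hx : (fun k => Y.π (t (x k))) = x := funext fun k => ht _
    constructor
    · intro h
      have := Y.of_forall hφ (fun k => t (x k)) fun _ => h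
      rwa [hx] at this
    · intro h
      by_contra h'
      have := Y.of_forall hφ.not (fun k => t (x k)) fun _ => h'
      rw [hx] at this
      exact this h⟩
  refine ⟨Y.N, i, Y.isTransitive_N, le_antisymm (Y.card_N_le.trans hT) ?_, ?_, fun b =>
    ⟨Y.π (c b), hfix _ b rfl, (hevt _).trans (hc b ())⟩⟩
  · have h1 : (2 ^ μ : Cardinal.{u}).toZFSet ⊆ Y.N := by
      intro x hx
      obtain ⟨b, hb⟩ := hord x hx
      rw [← hfix x b hb]
      exact (Y.π (c b)).2
    have h2 := ZFSet.card_mono h1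
    rwa [Cardinal.toZFSet, Ordinal.card_toZFSet, card_ord] at h2
  · refine Y.closedUnderSeq exists_isUPair_zfset (fun g h => ?_) (fun p a b a' b' h h' => ?_)
      (fun α => c (ob α)) (fun _ α β hαβ => ?_) (fun x => ?_) ?_ fun s => ?_
    · exact ⟨ZFSet.sep (fun p => ∃ a, E a h ∧ ∃ b, IsOPair p a b) g, fun p => by
        simp only [E_zfset, ZFSet.mem_sep]⟩
    · rw [isOPair_zfset] at h h'
      exact ZFSet.pair_inj.1 (h.symm.trans h')
    · have h1 : ev () (c (ob α)) = ev () (c (ob β)) := hαβ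
      rw [hc, hc, hob, hob] at h1
      exact ordSet_injective h1
    · rw [mem_toZFSet_iff_ordSet]
      refine exists_congr fun α => ?_
      rw [hfix _ _ (hob α)]
    · rw [← hfix _ bκ hbκ]
      exact (Y.π _).2
    · obtain ⟨q, hq⟩ := hseq s
      refine ⟨q, fun _ z => ?_⟩
      change E z (ev () q) ↔ ∃ α, IsOPair z (ev () (c (ob α))) (ev () (s α))
      rw [hq, E_zfset, ZFSet.mem_range]
      refine exists_congr fun α => ?_
      rw [isOPair_zfset, hc, hob, eq_comm]

/-! ### Tagged filter sets and the ultrafilter derived from an embedding -/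

/-- In the sense of the structure, every set `s` of size less than `k` admits an element of `m`
that lies in all those `y ∈ e` which are tagged by an element of `s` outside of `m`. -/
def SelectsPoint {A : Type v} [LSet.Structure A] (k m e : A) : Prop :=
  ∀ s f b, E b k → IsBij f s b →
    ∃ a, E a m ∧ ∀ y, E y e → (∃ g, E g s ∧ ¬ E g m ∧ E g y) → E a y

theorem Expressible.selectsPoint {α : Type*} (i j k : α) :
    Expressible.{v} fun _ _ w => SelectsPoint (w i) (w j) (w k) := by
  unfold SelectsPoint
  exact all (all (all (imp (mem _ _) (imp (isBij _ _ _) (ex (and (mem _ _) (all (imp (mem _ _)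
    (imp (ex (and (mem _ _) (and (not (mem _ _)) (mem _ _)))) (mem _ _))))))))))

theorem selectsPoint_zfset {κ μ : Cardinal.{u}} {F : Filter μ.ord.ToType} [F.NeBot]
    [CardinalInterFilter F κ] (g : {Y // Y ∈ F} → ZFSet.{u}) (hg : Function.Injective g) :
    SelectsPoint κ.toZFSet (code (Set.univ : Set μ.ord.ToType))
      (ZFSet.range fun Y : {Y // Y ∈ F} => insert (g Y) (code Y.1)) := by
  intro s f b hb hf
  obtain ⟨h1, h2⟩ := (isTransitiveClass_id.isBij_iff exists_isUPair_zfset).1 hf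
  let S : Set (Set μ.ord.ToType) := {Y | ∃ h : Y ∈ F, g ⟨Y, h⟩ ∈ s}
  have hS : ∀ Y ∈ S, Y ∈ F := fun Y ⟨h, _⟩ => h
  have hScard : #S < κ := by
    refine (card_le_of_isFunc h1 h2 (fun Y : S => g ⟨Y.1, hS _ Y.2⟩) (fun Y Y' h => ?_)
      fun Y => Y.2.2).trans_lt ?_
    · exact Subtype.ext (Subtype.mk.inj (hg h))
    · obtain ⟨α, hα, hα'⟩ := Ordinal.mem_toZFSet_iff.1 hb
      have hα'' : α.toZFSet = b := hα'
      change b.card < κ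
      rw [← hα'', Ordinal.card_toZFSet]
      exact lt_ord.1 hα
  obtain ⟨x, hx⟩ := Filter.nonempty_of_mem ((cardinal_sInter_mem (l := F) hScard).2 hS)
  refine ⟨ordSet x, ordSet_mem_code.2 (Set.mem_univ _), ?_⟩
  rintro y hy ⟨γ, hγs, hγm, hγy⟩
  obtain ⟨Y, rfl⟩ := ZFSet.mem_range.1 hy
  rcases ZFSet.mem_insert_iff.1 hγy with rfl | h
  · exact ZFSet.mem_insert_of_mem _ (ordSet_mem_code.2 (hx Y.1 ⟨Y.2, hγs⟩))
  · obtain ⟨x', -, rfl⟩ := mem_code.1 h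
    exact absurd (ordSet_mem_code.2 (Set.mem_univ _)) hγm

/-- Supplies the tags, of the form μ + ξ: being outside `μ` they cannot be confused with points, and
being below 2^μ their images lie in the covering set. -/
theorem exists_injective_toZFSet {μ : Cardinal.{u}} (hμ : ℵ₀ ≤ μ) (F : Filter μ.ord.ToType) :
    ∃ g : {Y // Y ∈ F} → ZFSet.{u}, Function.Injective g ∧ (∀ Y, g Y ∉ μ.toZFSet) ∧
      ∀ Y, g Y ∈ (2 ^ μ : Cardinal.{u}).toZFSet := by
  obtain ⟨G⟩ : Nonempty ({Y // Y ∈ F} ↪ (2 ^ μ : Cardinal.{u}).ord.ToType) := by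
    rw [← Cardinal.le_def, mk_ord_toType]
    refine (mk_subtype_le _).trans ?_
    rw [mk_set, mk_ord_toType]
  refine ⟨fun Y => (μ.ord + (Ordinal.ToType.mk.symm (G Y) : Ordinal.{u})).toZFSet, fun Y Y' h => ?_,
    fun Y h => ?_, fun Y => ?_⟩
  · exact G.injective (Ordinal.ToType.mk.symm.injective (Subtype.ext
      (add_left_cancel (Ordinal.toZFSet_injective h))))
  · exact absurd (Ordinal.toZFSet_mem_toZFSet_iff.1 h) (not_lt.2 le_self_add)
  · exact Ordinal.toZFSet_mem_toZFSet_iff.2 (Ordinal.isPrincipal_add_ord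
      (hμ.trans (cantor μ).le) (ord_lt_ord.2 (cantor μ)) (Ordinal.ToType.mk.symm (G Y)).2)

/-- The ultrafilter that is generated by an element of the image of `μ` under an elementary
embedding that fixes the ordinals below `κ` is `κ`-complete. -/
theorem exists_ultrafilter {κ μ : Cardinal.{u}} (hκ : ℵ₀ < κ) {M N : ZFSet.{u}}
    (hMt : M.IsTransitive) (hM : ModelsZFCMinus M) (hMκ : ClosedUnderSeq κ M)
    (j : M ↪ₑ[LSet] N) (hκM : κ.toZFSet ∈ M)
    (hfix : ∀ x : M, (x : ZFSet.{u}) ∈ κ.toZFSet → (j x : ZFSet.{u}) = x)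
    (cd : Set μ.ord.ToType → M) (hcd : ∀ Y, (cd Y : ZFSet.{u}) = code Y)
    (a : N) (ha : E a (j (cd Set.univ))) :
    ∃ U : Ultrafilter μ.ord.ToType, CardinalInterFilter (U : Filter μ.ord.ToType) κ ∧
      ∀ Y, Y ∈ U ↔ E a (j (cd Y)) := by
  have hv := isTransitiveClass_coe hMt
  have hmem : ∀ (z : M) Y, E z (cd Y) ↔ ∃ x ∈ Y, ordSet x = (z : ZFSet.{u}) := fun z Y => by
    rw [hv.mem_iff, hcd, mem_code]
  have hmem' : ∀ (z : M) (x : μ.ord.ToType), ordSet x = (z : ZFSet.{u}) →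
      ∀ Y, E z (cd Y) ↔ x ∈ Y := fun z x hx Y => by
    rw [hv.mem_iff, hcd, ← hx, ordSet_mem_code]
  have hmono : ∀ Y Y' : Set μ.ord.ToType, Y ⊆ Y' → E a (j (cd Y)) → E a (j (cd Y')) := by
    intro Y Y' hYY'
    refine (Expressible.map_iff (α := Fin 2) (P := fun _ _ w => ∀ z, E z (w 0) → E z (w 1))
      (.all (.imp (.mem _ _) (.mem _ _))) j ![cd Y, cd Y']).2 (fun z hz => ?_) a
    obtain ⟨x, hx, hxz⟩ := (hmem z Y).1 hz
    exact (hmem z Y').2 ⟨x, hYY' hx, hxz⟩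
  have hcompl : ∀ Y : Set μ.ord.ToType, ¬ E a (j (cd Yᶜ)) ↔ E a (j (cd Y)) := by
    intro Y
    refine (Expressible.map_iff (α := Fin 3)
      (P := fun _ _ w => ∀ z, E z (w 0) → (¬ E z (w 1) ↔ E z (w 2)))
      (.all (.imp (.mem _ _) (.iff (.not (.mem _ _)) (.mem _ _)))) j
      ![cd Set.univ, cd Yᶜ, cd Y]).2 (fun z hz => ?_) a ha
    obtain ⟨x, -, hx⟩ := (hmem z _).1 hz
    change ¬ E z (cd Yᶜ) ↔ E z (cd Y)
    rw [hmem' z x hx, hmem' z x hx, Set.mem_compl_iff, not_not]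
  have hinter : ∀ S : Set (Set μ.ord.ToType), #S < κ → S ⊆ {Y | E a (j (cd Y))} →
      E a (j (cd (⋂₀ S))) := by
    intro S hS hSa
    have hkM : ∀ y ∈ κ.toZFSet, y ∈ M := fun y hy => hMt _ hκM hy
    have hδκ := toZFSet_mem_toZFSet hS
    obtain ⟨e⟩ : Nonempty (S ≃ (#S).ord.ToType) := Cardinal.eq.1 (by rw [mk_ord_toType])
    have heδ : ∀ Y, ordSet (e Y) ∈ (#S).toZFSet := fun Y => mem_toZFSet_iff_ordSet.2 ⟨_, rfl⟩
    have heκ : ∀ Y, ordSet (e Y) ∈ κ.toZFSet := fun Y => isTransitive_toZFSet κ _ hδκ (heδ Y)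
    choose α hα using fun Y => mem_toZFSet_iff_ordSet.1 (heκ Y)
    have hαinj : Function.Injective α := fun Y Y' h =>
      e.injective (ordSet_injective (by rw [← hα, ← hα, h]))
    let o : κ.ord.ToType → M := fun α => ⟨ordSet α, hkM _ (mem_toZFSet_iff_ordSet.2 ⟨α, rfl⟩)⟩
    have hoinj : Function.Injective o := fun α β h => ordSet_injective (congrArg Subtype.val h)
    have hαo : ∀ Y, (o (α Y) : ZFSet.{u}) = ordSet (e Y) := hα
    -- The sequence is padded to length `κ` to use closure of `M`. Only indices below `#S` are
    -- consulted afterwards.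
    let f : κ.ord.ToType → M := Function.extend α (fun Y => cd Y.1) fun _ => cd Set.univ
    have hf : ∀ Y, f (α Y) = cd Y.1 := fun Y => hαinj.extend_apply _ _ Y
    obtain ⟨q, hq⟩ := exists_seq hMt hM hMκ o (fun _ => rfl) f
    have hrel : ∀ Y r, Related q (o (α Y)) r ↔ r = cd Y.1 := by
      intro Y r
      constructor
      · rintro ⟨p, hp, hpq⟩
        obtain ⟨β, hβ⟩ := (hq p).1 hpq
        rw [hv.isOPair_iff hM.pairing] at hp hβ
        obtain ⟨h1, h2⟩ := ZFSet.pair_inj.1 (hp.symm.trans hβ)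
        rw [← hf, hoinj (hv.injective h1)]
        exact hv.injective h2
      · rintro rfl
        obtain ⟨p, hp⟩ := hv.exists_isOPair hM.pairing (o (α Y)) (cd Y.1)
        exact ⟨p, hp, (hq p).2 ⟨α Y, by rwa [hf]⟩⟩
    let d : M := ⟨_, hkM _ hδκ⟩
    -- Since `d` and its elements are fixed, the image of the sequence has no new entries indexed by
    -- j(d): each is the image of the code of a member of `S`.
    have hjd : (j d : ZFSet.{u}) = (#S).toZFSet := hfix d hδκ
    refine (Expressible.map_iff (α := Fin 4) (P := fun _ _ w => ∀ z, E z (w 0) →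
      (∀ i, E i (w 1) → ∀ r, Related (w 2) i r → E z r) → E z (w 3))
      (.all (.imp (.mem _ _) (.imp (.all (.imp (.mem _ _) (.all (.imp (.related _ _ _)
        (.mem _ _))))) (.mem _ _)))) j ![cd Set.univ, d, q, cd (⋂₀ S)]).2 ?_ a ha ?_
    · intro z hz h
      obtain ⟨x, -, hx⟩ := (hmem z _).1 hz
      refine (hmem' z x hx _).2 fun Y hY => (hmem' z x hx _).1 ?_
      refine h (o (α ⟨Y, hY⟩)) ?_ _ ((hrel ⟨Y, hY⟩ _).2 rfl)
      change (o (α ⟨Y, hY⟩) : ZFSet.{u}) ∈ (#S).toZFSet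
      rw [hαo]
      exact heδ _
    · intro i hi r hr
      have hi' : (i : ZFSet.{u}) ∈ (#S).toZFSet := by
        rw [← hjd]
        exact hi
      obtain ⟨β, hβ⟩ := mem_toZFSet_iff_ordSet.1 hi'
      obtain ⟨Y, rfl⟩ := e.surjective β
      have hi2 : i = j (o (α Y)) := Subtype.ext (by
        rw [hfix _ (by rw [hαo]; exact heκ Y), hαo, hβ])
      have h1 : r = j (cd Y.1) := (Expressible.map_iff (α := Fin 3)
        (P := fun _ _ w => ∀ r, Related (w 0) (w 1) r → r = w 2)
        (.all (.imp (.related _ _ _) (.eq _ _))) j ![q, o (α Y), cd Y.1]).2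
        (fun r hr => (hrel Y r).1 hr) r (by subst hi2; exact hr)
      rw [h1]
      exact hSa Y.2
  have h2 : (2 : Cardinal.{u}) < κ := (natCast_lt_aleph0 (n := 2)).trans hκ
  have hmono' : ∀ Y Y', Y ∈ {Y | E a (j (cd Y))} → Y ⊆ Y' → Y' ∈ {Y | E a (j (cd Y))} :=
    fun Y Y' h h' => hmono Y Y' h' h
  refine ⟨.ofComplNotMemIff (.ofCardinalInter {Y | E a (j (cd Y))} h2 hinter hmono') hcompl, ?_,
    fun Y => Iff.rfl⟩
  exact Filter.cardinalInter_ofCardinalInter _ h2 hinter hmono'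

theorem filterExtensionProperty_of_embeddings {κ μ : Cardinal.{u}} (hκ : ℵ₀ < κ) (hκμ : κ ≤ μ)
    (h : ∀ M : ZFSet.{u}, M.IsTransitive → ModelsZFCMinus M →
      (2 ^ μ : Cardinal.{u}).toZFSet ⊆ M → M.card = 2 ^ μ → ClosedUnderSeq κ M →
      ∃ (N : ZFSet.{u}) (j : M ↪ₑ[LSet] N), N.IsTransitive ∧ HasCriticalPoint j κ ∧
        ClosedUnderSeq κ N ∧ ∃ s ∈ N,
          (∀ x : M, (x : ZFSet.{u}) ∈ (2 ^ μ : Cardinal.{u}).toZFSet → (j x : ZFSet.{u}) ∈ s) ∧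
          ∃ k : M, (k : ZFSet.{u}) = κ.toZFSet ∧ InnerCardLT N s (j k)) :
    FilterExtensionProperty κ μ := by
  intro F hF hFκ
  have hω : ℵ₀ ≤ μ := hκ.le.trans hκμ
  have hω' : ℵ₀ ≤ (2 : Cardinal.{u}) ^ μ := hω.trans (cantor μ).le
  obtain ⟨g, hg, hgμ, hgθ⟩ := exists_injective_toZFSet hω F
  let y : {Y // Y ∈ F} → ZFSet.{u} := fun Y => insert (g Y) (code Y.1)
  let B := (2 ^ μ : Cardinal.{u}).ord.ToType ⊕ Set μ.ord.ToType ⊕ {Y // Y ∈ F} ⊕ PUnit.{u + 1}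
  let base : B → ZFSet.{u} := Sum.elim ordSet (Sum.elim code (Sum.elim y fun _ => ZFSet.range y))
  have hB : #B ≤ 2 ^ μ := by
    have h1 : #(Set μ.ord.ToType) = 2 ^ μ := by rw [mk_set, mk_ord_toType]
    have h2 : #{Y // Y ∈ F} ≤ 2 ^ μ := (mk_subtype_le _).trans h1.le
    have h3 : #PUnit.{u + 1} ≤ 2 ^ μ := (lt_aleph0_of_finite _).le.trans hω'
    simp only [B, mk_sum, lift_id]
    exact add_le_of_le hω' (mk_ord_toType _).le
      (add_le_of_le hω' h1.le (add_le_of_le hω' h2 h3))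
  have hord : ∀ x ∈ (2 ^ μ : Cardinal.{u}).toZFSet, ∃ b, base b = x := by
    intro x hx
    obtain ⟨α, rfl⟩ := mem_toZFSet_iff_ordSet.1 hx
    exact ⟨Sum.inl α, rfl⟩
  have hcode : ∀ Y : Set μ.ord.ToType, ∀ z ∈ code Y, z ∈ (2 ^ μ : Cardinal.{u}).toZFSet := by
    intro Y z hz
    obtain ⟨x, -, rfl⟩ := mem_code.1 hz
    exact isTransitive_toZFSet _ _ (toZFSet_mem_toZFSet (cantor μ))
      (mem_toZFSet_iff_ordSet.2 ⟨x, rfl⟩)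
  obtain ⟨M, i, hMt, hMcard, hMκ, hMB⟩ := exists_transitive_model hκ hκμ hB base (by
    rintro (α | Y | Y | _) z hz
    · exact hord z (isTransitive_toZFSet _ _ (mem_toZFSet_iff_ordSet.2 ⟨α, rfl⟩) hz)
    · exact hord z (hcode Y z hz)
    · rcases ZFSet.mem_insert_iff.1 hz with rfl | hz
      · exact hord _ (hgθ Y)
      · exact hord z (hcode _ z hz)
    · obtain ⟨Y, rfl⟩ := ZFSet.mem_range.1 hz
      exact ⟨Sum.inr (Sum.inr (Sum.inl Y)), rfl⟩) hord
  have hM := modelsZFCMinus_of_elementary i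
  have hv := isTransitiveClass_coe hMt
  have hsub : (2 ^ μ : Cardinal.{u}).toZFSet ⊆ M := by
    intro x hx
    obtain ⟨b, rfl⟩ := hord x hx
    obtain ⟨a, ha, -⟩ := hMB b
    rw [← ha]
    exact a.2
  choose elt helt hielt using hMB
  let cd : Set μ.ord.ToType → M := fun Y => elt (Sum.inr (Sum.inl Y))
  have hcd : ∀ Y, (cd Y : ZFSet.{u}) = code Y := fun Y => helt _
  have hicd : ∀ Y, i (cd Y) = code Y := fun Y => hielt _
  let yM : {Y // Y ∈ F} → M := fun Y => elt (Sum.inr (Sum.inr (Sum.inl Y)))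
  have hyM : ∀ Y, (yM Y : ZFSet.{u}) = y Y := fun Y => helt _
  let eM : M := elt (Sum.inr (Sum.inr (Sum.inr PUnit.unit)))
  have heM : (eM : ZFSet.{u}) = ZFSet.range y := helt _
  have hieM : i eM = ZFSet.range y := hielt _
  obtain ⟨N, j, hNt, ⟨-, hcrit⟩, -, s, hsN, hs, k, hk, b, hbk, f, hfN, hf⟩ :=
    h M hMt hM hsub hMcard hMκ
  have hpN : ∀ a b : N, ∃ w, IsUPair w a b := (Expressible.map_iff (α := Fin 0)
    (P := fun _ _ _ => ∀ a b, ∃ w, IsUPair w a b) (.all (.all (.ex (.isUPair _ _ _)))) j ![]).2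
    hM.pairing
  have hκθ : κ.toZFSet ∈ (2 ^ μ : Cardinal.{u}).toZFSet :=
    toZFSet_mem_toZFSet (hκμ.trans_lt (cantor μ))
  have hik : i k = κ.toZFSet := by
    obtain ⟨α, hα⟩ := mem_toZFSet_iff_ordSet.1 hκθ
    have hk' : k = elt (Sum.inl α) := Subtype.ext (by rw [hk, helt, ← hα]; rfl)
    rw [hk', hielt, ← hα]
    rfl
  have hfix : ∀ x : M, (x : ZFSet.{u}) ∈ κ.toZFSet → (j x : ZFSet.{u}) = x := by
    intro x hx
    by_contra hne
    obtain ⟨α, hα, hαx⟩ := Ordinal.mem_toZFSet_iff.1 hx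
    exact absurd (hcrit ⟨x, hαx.symm, hne⟩) (not_le.2 hα)
  -- The selection property is proved in the universe, where `κ`-completeness of `F` applies, and
  -- then pulled back to `M` by elementarity.
  have hselM : SelectsPoint k (cd Set.univ) eM := by
    refine (Expressible.map_iff (α := Fin 3) (Expressible.selectsPoint 0 1 2) i
      ![k, cd Set.univ, eM]).1 ?_
    change SelectsPoint (i k) (i (cd Set.univ)) (i eM)
    rw [hik, hicd, hieM]
    exact selectsPoint_zfset g hg
  have hselN : SelectsPoint (j k) (j (cd Set.univ)) (j eM) :=
    (Expressible.map_iff (α := Fin 3) (Expressible.selectsPoint 0 1 2) j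
      ![k, cd Set.univ, eM]).2 hselM
  obtain ⟨a, ha, hay⟩ := hselN ⟨s, hsN⟩ ⟨f, hfN⟩ ⟨b, hNt _ (j k).2 hbk⟩ hbk
    (((isTransitiveClass_coe hNt).isBij_iff hpN).2 hf)
  obtain ⟨U, hU, hUmem⟩ := exists_ultrafilter hκ hMt hM hMκ j (hsub hκθ) hfix cd hcd a ha
  refine ⟨U, fun Y hY => (hUmem Y).2 ?_, hU⟩
  let gM : M := ⟨g ⟨Y, hY⟩, hsub (hgθ _)⟩
  have key : ∀ {x z : M}, E (j x) (j z) ↔ E x z := fun {x z} =>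
    Expressible.map_iff (α := Fin 2) (P := fun _ _ w => E (w 0) (w 1)) (.mem _ _) j ![x, z]
  have h1 : E a (j (yM ⟨Y, hY⟩)) := by
    refine hay _ (key.2 ?_) ⟨j gM, hs gM (hgθ _), fun h => ?_, key.2 ?_⟩
    · rw [hv.mem_iff, heM, hyM]
      exact ZFSet.mem_range.2 ⟨_, rfl⟩
    · have h' := key.1 h
      rw [hv.mem_iff, hcd] at h'
      obtain ⟨x, -, hx⟩ := mem_code.1 h'
      exact hgμ _ (mem_toZFSet_iff_ordSet.2 ⟨x, hx⟩)
    · rw [hv.mem_iff, hyM]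
      exact ZFSet.mem_insert _ _
  -- Inside `μ` the tagged set and the plain code agree because tags avoid `μ`; elementarity carries
  -- this to the point `a` of j(μ).
  refine (Expressible.map_iff (α := Fin 3)
    (P := fun _ _ w => ∀ z, E z (w 0) → E z (w 1) → E z (w 2))
    (.all (.imp (.mem _ _) (.imp (.mem _ _) (.mem _ _)))) j
    ![cd Set.univ, yM ⟨Y, hY⟩, cd Y]).2 (fun z hz hzy => ?_) a ha h1
  have hz' : E z (cd Set.univ) := hz
  have hzy' : E z (yM ⟨Y, hY⟩) := hzy
  change E z (cd Y)
  rw [hv.mem_iff, hcd] at hz' ⊢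
  rw [hv.mem_iff, hyM] at hzy'
  rcases ZFSet.mem_insert_iff.1 hzy' with h2 | h2
  · obtain ⟨x, -, hx⟩ := mem_code.1 hz'
    exact absurd (mem_toZFSet_iff_ordSet.2 ⟨x, hx.trans h2⟩) (hgμ _)
  · exact h2

end LSet

theorem lemma3p1 (κ μ : Cardinal.{u}) (hκ : ℵ₀ < κ) (hκμ : κ ≤ μ) (hμ : μ ^< κ = μ) :
    FilterExtensionProperty κ μ ↔
      ∀ M : ZFSet.{u}, M.IsTransitive → LSet.ModelsZFCMinus M →
        (2 ^ μ : Cardinal.{u}).toZFSet ⊆ M → M.card = 2 ^ μ → ClosedUnderSeq κ M →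
        ∃ (N : ZFSet.{u}) (j : M ↪ₑ[LSet] N), N.IsTransitive ∧
          HasCriticalPoint j κ ∧
          ClosedUnderSeq κ N ∧
          ∃ s ∈ N,
            (∀ x : M, (x : ZFSet.{u}) ∈ (2 ^ μ : Cardinal.{u}).toZFSet →
              (j x : ZFSet.{u}) ∈ s) ∧
            ∃ k : M, (k : ZFSet.{u}) = κ.toZFSet ∧ InnerCardLT N s (j k) := by
  refine ⟨fun h M hMt hM hμM hcard hMκ => ?_, LSet.filterExtensionProperty_of_embeddings hκ hκμ⟩
  obtain ⟨N, j, hNt, hj, hNκ, s, hsN, hs, hk⟩ :=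
    LSet.exists_embedding hκ hκμ hμ h hMt hM hμM hcard hMκ
  exact ⟨N, j, hNt, hj, hNκ, s, hsN, fun x _ => hs x, hk⟩
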